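/- Let $\Phi$ be a complete Bernstein function, that is, $$\Phi(z)=q+\mathfrak b z+\int_0^\infty(1-e^{-zy})\,\mu_\Phi(dy),\qquad \operatorname{Re} z>0,$$ where $q,\mathfrak b\ge 0$ and $\mu_\Phi$ is a measure on $(0,\infty)$ with $\int_0^\infty\min\{y,1\}\,\mu_\Phi(dy)<\infty$ that has a completely monotone density with respect to Lebesgue measure. Denote by $\Phi$ also its analytic continuation to $\mathbb C\setminus(-\infty,0]$. Let $\overline\mu_\Phi(t)=\mu_\Phi((t,\infty))$ for $t>0$, and let $\overline\mu_\Phi^{*1}=\overline\mu_\Phi$ and $\overline\mu_\Phi^{*n}(t)=\int_0^t\overline\mu_\Phi(s)\,\overline\mu_\Phi^{*(n-1)}(t-s)\,ds$ for $n\ge2$. Assume that the restriction of $\Phi$ to $\{\operatorname{Im} z>0\}$ extends to a continuous function $\Phi_+$ on $\{z\in\mathbb C:\operatorname{Im} z\ge0\}$. Put $\Phi^\dagger(z)=\Phi(z)-q-\mathfrak b z$ and $\Phi_+^\dagger(z)=\Phi_+(z)-q-\mathfrak b z$, and assume that $\Phi_+^\dagger(z)/z\to0$ as $|z|\to\infty$,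 uniformly in $\{\operatorname{Im} z\ge0\}$. Then, for all $\varepsilon,t>0$ and all integers $r\ge0$, $n\ge1$, the function $\overline\mu_\Phi^{*n}$ is $r$ times continuously differentiable near $t$, both integrals below converge absolutely, and $$\frac{d^r}{dt^r}\overline\mu_\Phi^{*n}(t)=\frac1\pi\int_\varepsilon^{\infty}\operatorname{Im}\left[(-1)^{r+n+1}\frac{(\Phi_+^\dagger(-\rho))^n}{\rho^{\,n-r}}e^{-t\rho}\right]d\rho+\frac1{2\pi i}\int_{\gamma_\varepsilon}e^{tz}\frac{(\Phi^\dagger(z))^n}{z^{\,n-r}}\,dz,$$ where $\gamma_\varepsilon$ is the curve $z=\varepsilon e^{i\xi}$, $\xi\in[-\pi,\pi]$. -/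

import Mathlib

open Set Filter Topology MeasureTheory
open scoped ContDiff

/-- A function that is completely monotone on `(0, ∞)`: it is smooth there and its derivatives alternate
in sign. -/
def CompletelyMonotoneOnPos (m : ℝ → ℝ) : Prop :=
  ContDiffOn ℝ ∞ m (Ioi 0) ∧ ∀ k : ℕ, ∀ y : ℝ, 0 < y → 0 ≤ (-1) ^ k * iteratedDeriv k m y

/-- A Bernstein function, given by its killing rate `q`, its drift `b` and its Lévy measure `μ`, a measure
carried by `(0, ∞)` with `∫ min(y, 1) μ(dy) < ∞`. Such a `μ` is finite on `[δ, ∞)` for every `δ > 0`,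
hence Radon on `(0, ∞)`. -/
structure BernsteinFunction where
  /-- killing rate -/
  q : ℝ
  /-- drift -/
  b : ℝ
  /-- Lévy measure -/
  μ : Measure ℝ
  q_nonneg : 0 ≤ q
  b_nonneg : 0 ≤ b
  μ_nonpos : μ (Iic 0) = 0
  μ_min : ∫⁻ y, ENNReal.ofReal (min y 1) ∂μ < ⊤

/-- The Lévy–Khintchine formula `q + b z + ∫ (1 - e^{-z y}) μ(dy)`, meaningful for `Re z ≥ 0`. -/
noncomputable def BernsteinFunction.eval (B : BernsteinFunction) (z : ℂ) : ℂ :=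
  (B.q : ℂ) + (B.b : ℂ) * z + ∫ y in Ioi (0 : ℝ), (1 - Complex.exp (-(z * (y : ℂ)))) ∂B.μ

/-- The Bernstein function is complete: its Lévy measure has a completely monotone density. -/
def BernsteinFunction.IsComplete (B : BernsteinFunction) : Prop :=
  ∃ m : ℝ → ℝ, CompletelyMonotoneOnPos m ∧
    B.μ = (volume.restrict (Ioi (0 : ℝ))).withDensity (fun y => ENNReal.ofReal (m y))

/-- `Φ` is the analytic continuation of the Bernstein function to `ℂ ∖ (-∞, 0]`. It is determined on
that set by `B`; the values of `Φ` on `(-∞, 0]` are irrelevant. -/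
def BernsteinFunction.IsContinuation (B : BernsteinFunction) (Φ : ℂ → ℂ) : Prop :=
  DifferentiableOn ℂ Φ Complex.slitPlane ∧ ∀ z : ℂ, 0 < z.re → Φ z = B.eval z

/-- `F` stripped of killing and drift: `F(z) - q - b z`. -/
noncomputable def BernsteinFunction.dagger (B : BernsteinFunction) (F : ℂ → ℂ) (z : ℂ) : ℂ :=
  F z - (B.q : ℂ) - (B.b : ℂ) * z

/-- The tail `t ↦ μ((t, ∞))` of the Lévy measure; it is finite for `t > 0`. -/
noncomputable def BernsteinFunction.tail (B : BernsteinFunction) (t : ℝ) : ℝ :=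
  (B.μ (Ioi t)).toReal

/-- The convolution `∫₀ᵗ f(s) g(t - s) ds` of functions on the half-line. -/
noncomputable def halfLineConv (f g : ℝ → ℝ) (t : ℝ) : ℝ :=
  ∫ s in (0 : ℝ)..t, f s * g (t - s)

/-- Convolution powers `f^{*1} = f`, `f^{*n} = f * f^{*(n-1)}` for `n ≥ 2`. The power `n = 0`, which is the Dirac
mass at `0` and not a function, gets a placeholder value. -/
noncomputable def convPow (f : ℝ → ℝ) : ℕ → ℝ → ℝ
  | 0 => fun _ => 0
  | 1 => f
  | n + 2 => halfLineConv f (convPow f (n + 1))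

/-- `Φp` is a continuous extension of `Φ`, from the open upper half-plane to the closed one. -/
def IsUpperExtension (Φ Φp : ℂ → ℂ) : Prop :=
  ContinuousOn Φp {z : ℂ | 0 ≤ z.im} ∧ ∀ z : ℂ, 0 < z.im → Φp z = Φ z

/-- `Im [(-1)^{r+n+1} G(-ρ)^n / ρ^{n-r} · e^{-tρ}]`. -/
noncomputable def rayIntegrand (G : ℂ → ℂ) (n r : ℕ) (t ρ : ℝ) : ℝ :=
  ((-1 : ℂ) ^ (r + n + 1) * (G (-(ρ : ℂ)) ^ n / (ρ : ℂ) ^ ((n : ℤ) - (r : ℤ))) *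
    Complex.exp (-((t : ℂ) * (ρ : ℂ)))).im

/-- `e^{tz} G(z)^n / z^{n-r}`. -/
noncomputable def circleIntegrand (G : ℂ → ℂ) (n r : ℕ) (t : ℝ) (z : ℂ) : ℂ :=
  Complex.exp ((t : ℂ) * z) * (G z ^ n / z ^ ((n : ℤ) - (r : ℤ)))

/-- The pullback `g(γ(ξ)) γ'(ξ)` of the form `g(z) dz` along the curve `γ(ξ) = ε e^{iξ}`. -/
noncomputable def circlePullback (g : ℂ → ℂ) (ε ξ : ℝ) : ℂ :=
  g ((ε : ℂ) * Complex.exp (Complex.I * (ξ : ℂ))) *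
    (Complex.I * ((ε : ℂ) * Complex.exp (Complex.I * (ξ : ℂ))))

/-! By Fubini, the Laplace transform of the tail is `Φ†(z)/z`, so that of its `n`-th convolution
power `f` is `(Φ†(z)/z)^n`. The formula is Laplace inversion along a Hankel contour: in along the
lower edge of the cut, once around the circle of radius `ε`, out along the upper edge. The two edges
carry conjugate values, so together they leave only an imaginary part.

The contour is not reached by deforming a vertical Bromwich line. Instead the Hankel integral is
taken as a candidate and its Laplace transform is computed. Under Fubini each `e^{tz}` becomes `1/(l
- z)`, so the result is a Cauchy integral over the keyhole contour, and Cauchy's formula returns the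
integrand's value at `l`. Injectivity of the Laplace transform then identifies the candidate.

The growth bound `|Φ₊†(z)| ≤ C|z|` away from the origin only makes `(Φ†/z)^n` bounded, which is too
weak for the edges and for the large circle. The argument is therefore run for the primitive of `f`,
whose transform has an extra factor `1/z`: everything becomes `O(1/|z|)`. For `t > 0` the factor
`e^{-tρ}` allows differentiation under the integral any number of times; `r + 1` derivatives of the
primitive give the `r`-th derivative of `f`.

Cauchy's formula is proved in the coordinate `w = log z`, where the keyhole region is the half-strip
`Re w > log ε`, `|Im w| < π`. The two edges of the cut become its distinct horizontal sides, and
rectangles suffice (`rectangle_integral_dslope_eq_zero`, `keyhole_cauchy_formula`,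
`hankelIntegral_laplace`, `eqOn_of_laplace_eq`). -/

open scoped ComplexConjugate

/-! ### Laplace transforms and convolution on the half-line -/

/-- `f` is continuous on `(0, ∞)` and its Laplace transform converges absolutely to `L z`
for `Re z > 0`. -/
def HasLaplaceTransform (f : ℝ → ℝ) (L : ℂ → ℂ) : Prop :=
  ContinuousOn f (Ioi 0) ∧ ∀ z : ℂ, 0 < z.re →
    IntegrableOn (fun s : ℝ => Complex.exp (-(z * s)) * f s) (Ioi 0) ∧
      ∫ s in Ioi (0 : ℝ), Complex.exp (-(z * s)) * f s = L z

/-- Convergence at `z = 1` controls a possible singularity of `f` at the origin, since the factor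
`e^s` that undoes the weight is bounded on `[0, T]`. -/
theorem HasLaplaceTransform.integrableOn_Ioc {f : ℝ → ℝ} {L : ℂ → ℂ}
    (h : HasLaplaceTransform f L) (T : ℝ) : IntegrableOn f (Ioc 0 T) := by
  have h1 := ((h.2 1 (by simp)).1).mono_set (fun s (hs : s ∈ Ioc 0 T) => hs.1)
  have h2 : IntegrableOn (fun s : ℝ => Complex.exp ((1 : ℂ) * s) *
      (Complex.exp (-((1 : ℂ) * s)) * f s)) (Ioc 0 T) := by
    rw [← integrableOn_Icc_iff_integrableOn_Ioc] at h1 ⊢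
    exact h1.continuousOn_mul (by fun_prop) isCompact_Icc
  have h3 : IntegrableOn (fun s : ℝ => (f s : ℂ)) (Ioc 0 T) := by
    refine h2.congr (ae_of_all _ fun s => ?_)
    simp only [← mul_assoc, ← Complex.exp_add]
    simp
  exact h3.re

/-- Reflecting the piece beyond `a` puts the singularity of either factor at the origin, so both
pieces can be treated by one argument. -/
theorem halfLineConv_eq_add (f g : ℝ → ℝ) {a t : ℝ} (hat : a ≤ t) (h0a : 0 ≤ a)
    (h : IntervalIntegrable (fun s => f s * g (t - s)) volume 0 t) :
    halfLineConv f g t = (∫ s in Ioc 0 a, f s * g (t - s)) +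
      ∫ s in Ioc 0 (t - a), g s * f (t - s) := by
  have e1 : ∫ s in a..t, f s * g (t - s) = ∫ s in (0 : ℝ)..(t - a), g s * f (t - s) := by
    have := intervalIntegral.integral_comp_sub_left (a := 0) (b := t - a)
      (fun s => f s * g (t - s)) t
    simp only [sub_sub_cancel, sub_zero] at this
    rw [← this]
    simp only [mul_comm]
  rw [halfLineConv, ← intervalIntegral.integral_add_adjacent_intervals (b := a), e1,
    intervalIntegral.integral_of_le h0a, intervalIntegral.integral_of_le (by linarith)]
  · exact h.mono_set (by rw [uIcc_of_le h0a, uIcc_of_le (h0a.trans hat)]; gcongr)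
  · exact h.mono_set (by rw [uIcc_of_le hat, uIcc_of_le (h0a.trans hat)]; gcongr)

theorem intervalIntegrable_conv {f g : ℝ → ℝ} (hf : ContinuousOn f (Ioi 0))
    (hg : ContinuousOn g (Ioi 0)) (hfi : ∀ T, IntegrableOn f (Ioc 0 T))
    (hgi : ∀ T, IntegrableOn g (Ioc 0 T)) {t : ℝ} (ht : 0 < t) :
    IntervalIntegrable (fun s => f s * g (t - s)) volume 0 t := by
  have key : ∀ {f g : ℝ → ℝ}, ContinuousOn g (Ioi 0) → (∀ T, IntegrableOn f (Ioc 0 T)) →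
      IntervalIntegrable (fun s => f s * g (t - s)) volume 0 (t / 2) := by
    intro f g hg hfi
    rw [intervalIntegrable_iff_integrableOn_Ioc_of_le (by linarith),
      ← integrableOn_Icc_iff_integrableOn_Ioc]
    refine IntegrableOn.mul_continuousOn ?_ ?_ isCompact_Icc
    · rw [integrableOn_Icc_iff_integrableOn_Ioc]; exact hfi _
    · refine hg.comp (by fun_prop) ?_
      intro s hs
      simp only [mem_Icc, mem_Ioi] at *
      linarith
  refine (key hg hfi).trans ?_
  have := (key hf hgi).comp_sub_left t
  simp only [sub_sub_cancel, sub_zero, sub_half] at this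
  simpa only [mul_comm] using this.symm

theorem continuousOn_halfLineConv {f g : ℝ → ℝ} (hf : ContinuousOn f (Ioi 0))
    (hg : ContinuousOn g (Ioi 0)) (hfi : ∀ T, IntegrableOn f (Ioc 0 T))
    (hgi : ∀ T, IntegrableOn g (Ioc 0 T)) : ContinuousOn (halfLineConv f g) (Ioi 0) := by
  intro t₀ ht₀
  rw [mem_Ioi] at ht₀
  apply ContinuousAt.continuousWithinAt
  -- One half of the convolution. For `t` near `t₀`, `s ≤ b t < 5t₀/8` and `t > 3t₀/4`, so `t - s`
  -- stays in `[t₀/8, 2t₀]`, where `g` is bounded, and `f` need only be integrable. The moving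
  -- endpoint is turned into an indicator, continuous in `t` at `t₀` unless `s = t₀/2`.
  have key : ∀ {f g : ℝ → ℝ} {b : ℝ → ℝ}, ContinuousOn g (Ioi 0) →
      (∀ T, IntegrableOn f (Ioc 0 T)) → ContinuousAt b t₀ → b t₀ = t₀ / 2 →
      ContinuousAt (fun t => ∫ s in Ioc 0 (b t), f s * g (t - s)) t₀ := by
    intro f g b hg hfi hb hb0
    obtain ⟨C, hC⟩ := (isCompact_Icc (a := t₀ / 8) (b := 2 * t₀)).exists_bound_of_continuousOn
      (hg.mono (fun x hx => by simp only [mem_Icc, mem_Ioi] at *; linarith))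
    have hbn : ∀ᶠ t in 𝓝 t₀, b t < 5 * t₀ / 8 :=
      hb.eventually (Iio_mem_nhds (by rw [hb0]; linarith))
    have htn : ∀ᶠ t in 𝓝 t₀, t ∈ Ioo (3 * t₀ / 4) (5 * t₀ / 4) :=
      Ioo_mem_nhds (by linarith) (by linarith)
    have hrw : ∀ᶠ t in 𝓝 t₀, ∫ s in Ioc 0 t₀, (Iic (b t)).indicator (fun s => f s * g (t - s)) s
        = ∫ s in Ioc 0 (b t), f s * g (t - s) := by
      filter_upwards [hbn] with t h1
      rw [setIntegral_indicator measurableSet_Iic]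
      congr 2
      ext s
      simp only [mem_inter_iff, mem_Ioc, mem_Iic]
      constructor
      · rintro ⟨⟨h, _⟩, h'⟩; exact ⟨h, h'⟩
      · rintro ⟨h, h'⟩; exact ⟨⟨h, by linarith⟩, h'⟩
    refine ContinuousAt.congr ?_ hrw
    refine continuousAt_of_dominated (bound := fun s => |f s| * C) ?_ ?_ ?_ ?_
    · filter_upwards [hbn, htn] with t h1 h2
      rw [aestronglyMeasurable_indicator_iff measurableSet_Iic,
        Measure.restrict_restrict measurableSet_Iic]
      refine ((hfi t₀).aestronglyMeasurable.mono_measure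
        (Measure.restrict_mono inter_subset_right le_rfl)).mul ?_
      refine ContinuousOn.aestronglyMeasurable ?_ (measurableSet_Iic.inter measurableSet_Ioc)
      refine hg.comp (by fun_prop) ?_
      intro s hs
      simp only [mem_Ioo, mem_inter_iff, mem_Iic, mem_Ioi] at *
      linarith [hs.1]
    · filter_upwards [hbn, htn] with t h1 h2
      refine (ae_restrict_iff' measurableSet_Ioc).2 (ae_of_all _ fun s hs => ?_)
      by_cases h : s ∈ Iic (b t)
      · rw [indicator_of_mem h, norm_mul, Real.norm_eq_abs]
        gcongr
        apply hC
        simp only [mem_Iic, mem_Ioo, mem_Ioc, mem_Icc] at *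
        constructor <;> linarith
      · rw [indicator_of_notMem h, norm_zero]
        have : 0 ≤ C := (norm_nonneg _).trans (hC t₀ ⟨by linarith, by linarith⟩)
        positivity
    · exact (hfi t₀).abs.mul_const C
    · have hne : ∀ᵐ s : ℝ, s ≠ t₀ / 2 := by simp [ae_iff]
      filter_upwards [ae_restrict_of_ae hne, ae_restrict_mem measurableSet_Ioc] with s hs hs'
      rcases lt_or_gt_of_ne hs with h | h
      · have h1 : ∀ᶠ t in 𝓝 t₀, s < b t := hb.eventually (Ioi_mem_nhds (by rw [hb0]; exact h))
        have h2 : ContinuousAt (fun t => f s * g (t - s)) t₀ := by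
          refine continuousAt_const.mul ?_
          refine ContinuousAt.comp (f := fun t => t - s) (g := g) ?_ (by fun_prop)
          exact hg.continuousAt (Ioi_mem_nhds (by linarith))
        refine h2.congr ?_
        filter_upwards [h1] with t ht
        rw [indicator_of_mem (mem_Iic.2 ht.le)]
      · have h1 : ∀ᶠ t in 𝓝 t₀, b t < s := hb.eventually (Iio_mem_nhds (by rw [hb0]; exact h))
        refine (continuousAt_const (y := (0 : ℝ))).congr ?_
        filter_upwards [h1] with t ht
        rw [indicator_of_notMem (by simpa using ht)]
  have h1 := key (b := fun _ => t₀ / 2) hg hfi continuousAt_const rfl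
  have h2 := key (b := fun t => t - t₀ / 2) hf hgi (by fun_prop) (by ring)
  refine (h1.add h2).congr ?_
  filter_upwards [Ioi_mem_nhds (show t₀ / 2 < t₀ by linarith)] with t ht
  rw [mem_Ioi] at ht
  rw [halfLineConv_eq_add f g ht.le (by linarith)
    (intervalIntegrable_conv hf hg hfi hgi (by linarith))]
  rfl

/-- The weight `e^{-zx}` is multiplicative, so the weighted convolution is the convolution of the
weighted functions, and its integral factors. -/
theorem HasLaplaceTransform.halfLineConv {f g : ℝ → ℝ} {L M : ℂ → ℂ}
    (hf : HasLaplaceTransform f L) (hg : HasLaplaceTransform g M) :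
    HasLaplaceTransform (halfLineConv f g) (fun z => L z * M z) := by
  refine ⟨continuousOn_halfLineConv hf.1 hg.1 hf.integrableOn_Ioc hg.integrableOn_Ioc, ?_⟩
  intro z hz
  obtain ⟨hf1, hf2⟩ := hf.2 z hz
  obtain ⟨hg1, hg2⟩ := hg.2 z hz
  have e : ∀ x : ℝ, ∫ t in (0 : ℝ)..x, ContinuousLinearMap.mul ℝ ℂ (Complex.exp (-(z * t)) * f t)
      (Complex.exp (-(z * (x - t : ℝ))) * g (x - t)) =
      Complex.exp (-(z * x)) * (_root_.halfLineConv f g x : ℝ) := by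
    intro x
    rw [_root_.halfLineConv, ← intervalIntegral.integral_ofReal,
      ← intervalIntegral.integral_const_mul]
    congr 1
    ext t
    simp only [ContinuousLinearMap.mul_apply', Complex.ofReal_mul, Complex.ofReal_sub]
    rw [show -(z * x) = -(z * t) + -(z * (x - t : ℂ)) by ring, Complex.exp_add]
    ring
  have h1 := integrable_posConvolution hf1 hg1 (ContinuousLinearMap.mul ℝ ℂ)
  have h2 := integral_posConvolution hf1 hg1 (ContinuousLinearMap.mul ℝ ℂ)
  simp only [e] at h2
  refine ⟨?_, ?_⟩
  · refine (h1.integrableOn (s := Ioi 0)).congr_fun ?_ measurableSet_Ioi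
    intro x hx
    simp only [posConvolution, indicator_of_mem hx]
    exact e x
  · rw [h2, hf2, hg2]; rfl

theorem hasLaplaceTransform_one : HasLaplaceTransform (fun _ => 1) (fun z => 1 / z) := by
  refine ⟨continuousOn_const, fun z hz => ?_⟩
  have h1 := integrableOn_exp_mul_complex_Ioi (a := -z) (by simpa) 0
  have h2 := integral_exp_mul_complex_Ioi (a := -z) (by simpa) 0
  simp only [neg_mul] at h1 h2
  simp [h1, h2]

/-! ### The tail of the Lévy measure and the transform of its convolution powers -/

namespace BernsteinFunction

theorem IsComplete.sFinite {B : BernsteinFunction} (hB : B.IsComplete) : SFinite B.μ := by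
  obtain ⟨m, -, h⟩ := hB
  rw [h]
  infer_instance

theorem IsComplete.absolutelyContinuous {B : BernsteinFunction} (hB : B.IsComplete) :
    B.μ ≪ volume := by
  obtain ⟨m, -, h⟩ := hB
  rw [h]
  exact (withDensity_absolutelyContinuous _ _).trans Measure.absolutelyContinuous_restrict

theorem ae_pos (B : BernsteinFunction) : ∀ᵐ y ∂B.μ, 0 < y := by
  rw [ae_iff]
  convert B.μ_nonpos using 2
  ext y
  simp

theorem integrable_min (B : BernsteinFunction) : Integrable (fun y => min y 1) B.μ := by
  refine ⟨by fun_prop, ?_⟩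
  rw [hasFiniteIntegral_iff_ofReal]
  · exact B.μ_min
  · filter_upwards [B.ae_pos] with y hy
    exact le_min hy.le zero_le_one

theorem measure_Ioi_lt_top (B : BernsteinFunction) {t : ℝ} (ht : 0 < t) : B.μ (Ioi t) < ⊤ := by
  refine lt_of_le_of_lt (measure_mono ?_)
    (B.integrable_min.measure_norm_ge_lt_top (ε := min t 1) (by positivity))
  intro y hy
  have hy' : t < y := hy
  have : 0 ≤ min y 1 := le_min (ht.trans hy').le zero_le_one
  simp only [mem_ofPred_eq, Real.norm_eq_abs, abs_of_nonneg this]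
  exact min_le_min hy'.le le_rfl

/-- A measure with a density has no atoms, so the indicator of `(t, ∞)` is almost everywhere
continuous in `t` at `t₀`; its dominating function is the indicator of `(t₀/2, ∞)`, of finite
measure. -/
theorem continuousOn_tail {B : BernsteinFunction} (hB : B.IsComplete) :
    ContinuousOn B.tail (Ioi 0) := by
  intro t₀ ht₀
  rw [mem_Ioi] at ht₀
  apply ContinuousAt.continuousWithinAt
  have e : B.tail = fun t => ∫ y, (Ioi t).indicator (fun _ => (1 : ℝ)) y ∂B.μ := by
    ext t
    rw [integral_indicator_const _ measurableSet_Ioi]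
    simp [tail, Measure.real]
  rw [e]
  refine continuousAt_of_dominated (bound := (Ioi (t₀ / 2)).indicator (fun _ => (1 : ℝ)))
    (Eventually.of_forall fun t =>
      (measurable_const.indicator measurableSet_Ioi).aestronglyMeasurable) ?_ ?_ ?_
  · filter_upwards [Ioi_mem_nhds (show t₀ / 2 < t₀ by linarith)] with t ht
    refine ae_of_all _ fun y => ?_
    rw [norm_indicator_eq_indicator_norm, norm_one]
    exact indicator_le_indicator_of_subset (Ioi_subset_Ioi (le_of_lt ht))
      (fun _ => zero_le_one) y
  · rw [integrable_indicator_iff measurableSet_Ioi]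
    exact integrableOn_const (B.measure_Ioi_lt_top (by linarith)).ne
  · have hne : ∀ᵐ s : ℝ, s ≠ t₀ := by simp [ae_iff]
    filter_upwards [hB.absolutelyContinuous.ae_le hne] with s hs
    rcases lt_or_gt_of_ne hs with h | h
    · refine (continuousAt_const (y := (0 : ℝ))).congr ?_
      filter_upwards [Ioi_mem_nhds h] with t ht
      rw [indicator_of_notMem (by simpa using le_of_lt ht)]
    · refine (continuousAt_const (y := (1 : ℝ))).congr ?_
      filter_upwards [Iio_mem_nhds h] with t ht
      rw [indicator_of_mem (by simpa using ht)]

theorem integrableOn_cexp_Ioc (z : ℂ) (y : ℝ) :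
    IntegrableOn (fun s : ℝ => Complex.exp (-(z * s))) (Ioc 0 y) := by
  rw [← integrableOn_Icc_iff_integrableOn_Ioc]
  exact ContinuousOn.integrableOn_Icc (by fun_prop)

/-- Bounding the integrand by `1` gives `y`; extending the interval to the half-line gives `1 / Re
z`. The product form matches the integrability condition on the Lévy measure. -/
theorem integral_norm_cexp_Ioc_le {z : ℂ} (hz : 0 < z.re) {y : ℝ} (hy : 0 < y) :
    ∫ s in Ioc 0 y, ‖Complex.exp (-(z * (s : ℂ)))‖ ≤ max 1 (1 / z.re) * min y 1 := by
  have hn : ∀ s : ℝ, ‖Complex.exp (-(z * (s : ℂ)))‖ = Real.exp (-z.re * s) := by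
    intro s; rw [Complex.norm_exp]; simp
  simp only [hn]
  have h1 : ∫ s in Ioc 0 y, Real.exp (-z.re * s) ≤ y := by
    calc _ ≤ ∫ s in Ioc 0 y, (1 : ℝ) := by
          refine setIntegral_mono_on ?_ (integrableOn_const (by simp)) measurableSet_Ioc ?_
          · rw [← integrableOn_Icc_iff_integrableOn_Ioc]
            exact ContinuousOn.integrableOn_Icc (by fun_prop)
          · intro s hs
            apply Real.exp_le_one_iff.2
            nlinarith [hs.1]
      _ = y := by simp [hy.le]
  have h2 : ∫ s in Ioc 0 y, Real.exp (-z.re * s) ≤ 1 / z.re := by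
    calc _ ≤ ∫ s in Ioi (0 : ℝ), Real.exp (-z.re * s) := by
          refine setIntegral_mono_set (integrableOn_exp_mul_Ioi (by linarith) _)
            (ae_of_all _ fun s => (Real.exp_pos _).le) ?_
          exact Eventually.of_forall fun s hs => hs.1
      _ = 1 / z.re := by rw [integral_exp_mul_Ioi (by linarith)]; simp [neg_div_neg_eq]
  rcases le_total y 1 with h | h
  · rw [min_eq_left h]
    exact h1.trans (le_mul_of_one_le_left hy.le (le_max_left _ _))
  · rw [min_eq_right h, mul_one]
    exact h2.trans (le_max_right _ _)

theorem integral_cexp_Ioc {z : ℂ} (hz : z ≠ 0) {y : ℝ} (hy : 0 ≤ y) :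
    z * ∫ s in Ioc 0 y, Complex.exp (-(z * (s : ℂ))) = 1 - Complex.exp (-(z * y)) := by
  have := integral_exp_mul_complex (a := 0) (b := y) (neg_ne_zero.2 hz)
  simp only [neg_mul] at this
  rw [← intervalIntegral.integral_of_le hy, this]
  field_simp
  simp

/-- The Laplace transform of the tail of the Lévy measure, by Fubini's theorem. -/
theorem hasLaplaceTransform_tail {B : BernsteinFunction} (hB : B.IsComplete) :
    HasLaplaceTransform B.tail (fun z => B.dagger B.eval z / z) := by
  refine ⟨continuousOn_tail hB, fun z hz => ?_⟩
  have hz0 : z ≠ 0 := by rintro rfl; simp at hz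
  have := hB.sFinite
  -- The kernel `e^{-zs}` on `s ≤ y` gives `(1 - e^{-zy})/z` when integrated in `s`, and `e^{-zs}`
  -- times the tail when integrated in `y`.
  let S : Set (ℝ × ℝ) := {p | p.2 ≤ p.1}
  have hS : MeasurableSet S := measurableSet_le measurable_snd measurable_fst
  let K : ℝ × ℝ → ℂ := S.indicator fun p => Complex.exp (-(z * (p.2 : ℂ)))
  have hKm : AEStronglyMeasurable K (B.μ.prod (volume.restrict (Ioi 0))) := by
    refine StronglyMeasurable.aestronglyMeasurable (StronglyMeasurable.indicator ?_ hS)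
    exact Continuous.stronglyMeasurable (by fun_prop)
  have hK1 : ∀ y, (fun s => K (y, s)) = (Iic y).indicator fun s : ℝ => Complex.exp (-(z * (s : ℂ))) := by
    intro y; ext s; simp [K, S, indicator]
  have hI : ∀ y : ℝ, Iic y ∩ Ioi 0 = Ioc 0 y := by
    intro y; ext s; simp [and_comm]
  have hK : Integrable K (B.μ.prod (volume.restrict (Ioi 0))) := by
    rw [integrable_prod_iff hKm]
    constructor
    · refine ae_of_all _ fun y => ?_
      rw [hK1, integrable_indicator_iff measurableSet_Iic, IntegrableOn,
        Measure.restrict_restrict measurableSet_Iic, hI]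
      exact integrableOn_cexp_Ioc z y
    · refine (B.integrable_min.const_mul (max 1 (1 / z.re))).mono' hKm.norm.integral_prod_right' ?_
      filter_upwards [B.ae_pos] with y hy
      rw [Real.norm_eq_abs, abs_of_nonneg (integral_nonneg fun _ => norm_nonneg _)]
      refine le_trans (le_of_eq ?_) (integral_norm_cexp_Ioc_le hz hy)
      rw [← hI, ← Measure.restrict_restrict measurableSet_Iic,
        ← integral_indicator measurableSet_Iic]
      congr 1
      ext s
      rw [congrFun (hK1 y) s, norm_indicator_eq_indicator_norm]
  have hK2 : ∀ s : ℝ, 0 < s → ∫ y, K (y, s) ∂B.μ = Complex.exp (-(z * s)) * B.tail s := by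
    intro s hs
    have : (fun y => K (y, s)) = (Ici s).indicator fun _ => Complex.exp (-(z * (s : ℂ))) := by
      ext y; simp [K, S, indicator]
    rw [this, integral_indicator_const _ measurableSet_Ici]
    have hm : B.μ (Ici s) = B.μ (Ioi s) := by
      refine measure_congr (hB.absolutelyContinuous.ae_le ?_)
      exact Ioi_ae_eq_Ici.symm
    rw [Measure.real, hm, Complex.real_smul, mul_comm]
    rfl
  refine ⟨?_, ?_⟩
  · refine IntegrableOn.congr_fun (f := fun s => ∫ y, K (y, s) ∂B.μ) hK.integral_prod_right ?_
      measurableSet_Ioi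
    intro s hs
    exact hK2 s hs
  · have e1 : ∫ s in Ioi (0 : ℝ), Complex.exp (-(z * s)) * B.tail s =
        ∫ s in Ioi (0 : ℝ), ∫ y, K (y, s) ∂B.μ :=
      (setIntegral_congr_fun measurableSet_Ioi fun s hs => hK2 s hs).symm
    have e2 := integral_integral_swap (f := fun y s => K (y, s)) hK
    rw [e1, ← e2]
    have e3 : B.dagger B.eval z = ∫ y, (1 - Complex.exp (-(z * (y : ℂ)))) ∂B.μ := by
      simp only [dagger, eval]
      rw [Measure.restrict_eq_self_of_ae_mem (s := Ioi (0 : ℝ)) B.ae_pos]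
      ring
    change _ = B.dagger B.eval z / z
    rw [e3, eq_div_iff hz0, mul_comm, ← integral_const_mul]
    refine integral_congr_ae ?_
    filter_upwards [B.ae_pos] with y hy
    rw [hK1, integral_indicator measurableSet_Iic, Measure.restrict_restrict measurableSet_Iic, hI]
    exact integral_cexp_Ioc hz0 hy.le

end BernsteinFunction

theorem HasLaplaceTransform.convPow {f : ℝ → ℝ} {L : ℂ → ℂ} (h : HasLaplaceTransform f L) :
    ∀ {n : ℕ}, 1 ≤ n → HasLaplaceTransform (convPow f n) (fun z => L z ^ n) := by
  intro n hn
  induction n, hn using Nat.le_induction with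
  | base => simpa [_root_.convPow] using h
  | succ k hk ih =>
    obtain ⟨j, rfl⟩ := Nat.exists_eq_add_of_le' hk
    simpa only [_root_.convPow, pow_succ'] using h.halfLineConv ih

/-! ### Superpositions of exponentials -/

/-- Differentiation under the integral sign for `t ↦ ∫ z ^ k e ^ {t z} a dν`. -/
theorem hasDerivAt_integral_pow_mul_cexp {α : Type*} [MeasurableSpace α] {ν : Measure α}
    {z a : α → ℂ} (hI : ∀ t : ℝ, 0 < t → ∀ k : ℕ,
      Integrable (fun x => z x ^ k * Complex.exp (t * z x) * a x) ν) (k : ℕ) {t : ℝ} (ht : 0 < t) :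
    HasDerivAt (fun s : ℝ => ∫ x, z x ^ k * Complex.exp (s * z x) * a x ∂ν)
      (∫ x, z x ^ (k + 1) * Complex.exp (t * z x) * a x ∂ν) t := by
  -- `Re z` may have either sign, so `|e^{sz}|` is dominated by the sum of its values at both ends
  -- of the interval for `s`.
  have h1 := hI (t / 2) (by linarith) (k + 1)
  have h2 := hI (3 * t / 2) (by linarith) (k + 1)
  refine (hasDerivAt_integral_of_dominated_loc_of_deriv_le (𝕜 := ℝ)
    (s := Ioo (t / 2) (3 * t / 2))
    (F := fun s x => z x ^ k * Complex.exp (s * z x) * a x)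
    (F' := fun s x => z x ^ (k + 1) * Complex.exp (s * z x) * a x)
    (Ioo_mem_nhds (by linarith) (by linarith)) ?_ (hI t ht k)
    (hI t ht (k + 1)).aestronglyMeasurable ?_ (h1.norm.add h2.norm) ?_).2
  · filter_upwards [Ioi_mem_nhds ht] with s hs
    exact (hI s hs k).aestronglyMeasurable
  · refine ae_of_all _ fun x s hs => ?_
    simp only [Pi.add_apply, norm_mul, Complex.norm_exp, Complex.re_ofReal_mul]
    rw [← add_mul, ← mul_add]
    gcongr
    rcases le_total 0 (z x).re with h | h
    · refine le_add_of_nonneg_of_le (Real.exp_pos _).le (Real.exp_le_exp.2 ?_)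
      exact mul_le_mul_of_nonneg_right hs.2.le h
    · refine le_add_of_le_of_nonneg (Real.exp_le_exp.2 ?_) (Real.exp_pos _).le
      exact mul_le_mul_of_nonpos_right hs.1.le h
  · refine ae_of_all _ fun x s _ => ?_
    have h3 : HasDerivAt (fun s : ℝ => Complex.exp (s * z x))
        (Complex.exp (s * z x) * (1 * z x)) s :=
      ((hasDerivAt_id s).ofReal_comp.mul_const (z x)).cexp
    convert! (h3.const_mul (z x ^ k)).mul_const (a x) using 1
    ring

/-- Integrating the modulus in `t` first gives exactly `|a| / (Re l - Re z)`, whose integrability is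
the hypothesis. -/
theorem integrable_cexp_mul_prod {α : Type*} [MeasurableSpace α] {ν : Measure α} [SFinite ν]
    {z a : α → ℂ} (hz : Measurable z) (ha : AEStronglyMeasurable a ν) {l : ℂ}
    (hl : ∀ᵐ x ∂ν, (z x).re < l.re) (hI : Integrable (fun x => ‖a x‖ / (l.re - (z x).re)) ν) :
    Integrable (fun p : ℝ × α => Complex.exp (-(l * p.1)) * (Complex.exp (p.1 * z p.2) * a p.2))
      ((volume.restrict (Ioi 0)).prod ν) := by
  rw [integrable_prod_iff']
  · constructor
    · filter_upwards [hl] with x hx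
      have := integrableOn_exp_mul_complex_Ioi (a := z x - l) (by simpa using hx) 0
      refine (this.mul_const (a x)).congr (ae_of_all _ fun t => ?_)
      simp only [← mul_assoc, ← Complex.exp_add]
      ring_nf
    · refine hI.congr ?_
      filter_upwards [hl] with x hx
      have : ∀ t : ℝ, ‖Complex.exp (-(l * t)) * (Complex.exp (t * z x) * a x)‖ =
          Real.exp (((z x).re - l.re) * t) * ‖a x‖ := by
        intro t
        rw [← mul_assoc, ← Complex.exp_add, norm_mul, Complex.norm_exp]
        congr 2
        simp
        ring
      simp only [this]
      rw [integral_mul_const, integral_exp_mul_Ioi (by linarith)]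
      simp only [mul_zero, Real.exp_zero, ← neg_sub l.re, neg_div_neg_eq]
      ring
  · refine AEStronglyMeasurable.mul ?_ (AEStronglyMeasurable.mul ?_ ha.comp_snd)
    · exact (Continuous.aestronglyMeasurable (by fun_prop) : AEStronglyMeasurable
        (fun t : ℝ => Complex.exp (-(l * t))) (volume.restrict (Ioi 0))).comp_fst
    · exact Measurable.aestronglyMeasurable (by fun_prop)

theorem integrableOn_cexp_mul_integral {α : Type*} [MeasurableSpace α] {ν : Measure α} [SFinite ν]
    {z a : α → ℂ} (hz : Measurable z) (ha : AEStronglyMeasurable a ν) {l : ℂ}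
    (hl : ∀ᵐ x ∂ν, (z x).re < l.re) (hI : Integrable (fun x => ‖a x‖ / (l.re - (z x).re)) ν) :
    IntegrableOn (fun t : ℝ => Complex.exp (-(l * t)) * ∫ x, Complex.exp (t * z x) * a x ∂ν)
      (Ioi 0) := by
  refine (integrable_cexp_mul_prod hz ha hl hI).integral_prod_left.congr (ae_of_all _ fun t => ?_)
  simp only [integral_const_mul]

/-- The transform of `e^{tz}` is `1/(l - z)`; this is what turns a contour integral of exponentials
into a Cauchy integral. -/
theorem integral_cexp_mul_integral {α : Type*} [MeasurableSpace α] {ν : Measure α} [SFinite ν]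
    {z a : α → ℂ} (hz : Measurable z) (ha : AEStronglyMeasurable a ν) {l : ℂ}
    (hl : ∀ᵐ x ∂ν, (z x).re < l.re) (hI : Integrable (fun x => ‖a x‖ / (l.re - (z x).re)) ν) :
    ∫ t in Ioi (0 : ℝ), Complex.exp (-(l * t)) * ∫ x, Complex.exp (t * z x) * a x ∂ν =
      ∫ x, a x / (l - z x) ∂ν := by
  simp only [← integral_const_mul]
  rw [integral_integral_swap (integrable_cexp_mul_prod hz ha hl hI)]
  refine integral_congr_ae ?_
  filter_upwards [hl] with x hx
  have h := integral_exp_mul_complex_Ioi (a := z x - l) (by simpa using hx) 0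
  have e : ∀ t : ℝ, Complex.exp (-(l * t)) * (Complex.exp (t * z x) * a x) =
      Complex.exp ((z x - l) * t) * a x := by
    intro t
    rw [← mul_assoc, ← Complex.exp_add]
    ring_nf
  simp only [e]
  rw [integral_mul_const, h]
  simp only [Complex.ofReal_zero, mul_zero, Complex.exp_zero, ← neg_sub l, neg_div_neg_eq]
  ring

/-! ### Uniqueness of the Laplace transform -/

/-- A continuous function on `(0, ∞)` is determined by its Laplace transform on a vertical line. -/
theorem eqOn_of_laplace_eq {f g : ℝ → ℂ} (hf : ContinuousOn f (Ioi 0)) (hg : ContinuousOn g (Ioi 0))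
    {c : ℝ}
    (hfi : ∀ l : ℂ, l.re = c → IntegrableOn (fun t : ℝ => Complex.exp (-(l * t)) * f t) (Ioi 0))
    (hgi : ∀ l : ℂ, l.re = c → IntegrableOn (fun t : ℝ => Complex.exp (-(l * t)) * g t) (Ioi 0))
    (h : ∀ l : ℂ, l.re = c → ∫ t in Ioi (0 : ℝ), Complex.exp (-(l * t)) * f t =
      ∫ t in Ioi (0 : ℝ), Complex.exp (-(l * t)) * g t) : EqOn f g (Ioi 0) := by
  let k : ℝ → ℂ := (Ioi 0).indicator fun t => Complex.exp (-(c * t)) * (f t - g t)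
  have hk : Integrable k := by
    rw [integrable_indicator_iff measurableSet_Ioi]
    refine ((hfi c (by simp)).sub (hgi c (by simp))).congr (ae_of_all _ fun t => ?_)
    simp only [Pi.sub_apply]
    ring
  -- At frequency `y` this is the difference of the two Laplace transforms at `c + 2πiy`.
  have hF : FourierTransform.fourier k = 0 := by
    ext y
    rw [Real.fourier_real_eq]
    have e : ∀ t : ℝ, Real.fourierChar (-(t * y)) • k t = (Ioi (0 : ℝ)).indicator (fun t =>
        Complex.exp (-((c + 2 * Real.pi * y * Complex.I) * t)) * f t -
        Complex.exp (-((c + 2 * Real.pi * y * Complex.I) * t)) * g t) t := by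
      intro t
      simp only [k, indicator]
      split_ifs
      · rw [Circle.smul_def, Real.fourierChar_apply, smul_eq_mul, ← mul_assoc, ← Complex.exp_add,
          ← mul_sub]
        congr 2
        push_cast
        ring
      · simp
    have hl : ((c : ℂ) + 2 * Real.pi * y * Complex.I).re = c := by simp
    simp only [e]
    rw [integral_indicator measurableSet_Ioi, integral_sub (hfi _ hl) (hgi _ hl), h _ hl, sub_self]
    rfl
  intro t ht
  have hkt : ContinuousAt k t := by
    have h1 : ContinuousAt (fun t : ℝ => Complex.exp (-(c * t)) * (f t - g t)) t := by
      refine ContinuousAt.mul (by fun_prop) ?_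
      exact (hf.continuousAt (Ioi_mem_nhds ht)).sub (hg.continuousAt (Ioi_mem_nhds ht))
    refine h1.congr ?_
    filter_upwards [Ioi_mem_nhds ht] with s hs
    simp only [k]
    rw [indicator_of_mem hs]
  -- Pointwise inversion needs continuity only at `t`, so a jump of `k` at `0` is harmless.
  have h2 := hk.fourierInv_fourier_eq (by rw [hF]; exact integrable_zero ℝ ℂ volume) hkt
  have h3 : k t = 0 := by
    rw [← h2, hF, show (0 : ℝ → ℂ) = fun _ => 0 from rfl, Real.fourierInv_eq]
    simp
  simp only [k, indicator_of_mem (s := Ioi (0 : ℝ)) ht, mul_eq_zero, Complex.exp_ne_zero, false_or, sub_eq_zero] at h3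
  exact h3

/-! ### Cauchy's formula for the keyhole region -/

/-- With `z = e^{b + iy}` one has `dz = iz dy`; periodicity moves `[-π, π]` to the interval `[0,
2π]` of the circle integral. -/
theorem integral_cexp_div_eq_circleIntegral (b : ℝ) (l : ℂ) :
    Complex.I * ∫ y in (-Real.pi)..Real.pi,
        Complex.exp (b + y * Complex.I) / (Complex.exp (b + y * Complex.I) - l) =
      ∮ z in C(0, Real.exp b), (z - l)⁻¹ := by
  have e : ∀ y : ℝ, circleMap 0 (Real.exp b) y = Complex.exp (b + y * Complex.I) := by
    intro y; simp [circleMap, Complex.exp_add]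
  have hp : Function.Periodic (fun y : ℝ =>
      Complex.exp (b + y * Complex.I) / (Complex.exp (b + y * Complex.I) - l)) (2 * Real.pi) := by
    intro y
    simp only [← e, periodic_circleMap _ _ _]
  have h := hp.intervalIntegral_add_eq (-Real.pi) 0
  rw [show -Real.pi + 2 * Real.pi = Real.pi by ring, zero_add] at h
  rw [h, circleIntegral, ← intervalIntegral.integral_const_mul]
  congr 1
  ext y
  simp only [deriv_circleMap, smul_eq_mul, e]
  ring

/-- Equal exponentials differ by `2πin`. One strict bound makes the imaginary parts differ by less
than `2π`, so `w` may lie on the boundary of the strip. -/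
theorem cexp_sub_ne_zero_of_mem_strip {w w₀ : ℂ} (hw : |w.im| ≤ Real.pi) (hw₀ : |w₀.im| < Real.pi)
    (h : w ≠ w₀) : Complex.exp w - Complex.exp w₀ ≠ 0 := by
  rw [sub_ne_zero]
  intro he
  obtain ⟨n, hn⟩ := Complex.exp_eq_exp_iff_exists_int.1 he
  have him : w.im = w₀.im + n * (2 * Real.pi) := by rw [hn]; simp
  have hpi := Real.pi_pos
  rw [abs_le] at hw
  rw [abs_lt] at hw₀
  have h1 : (n : ℝ) < 1 := by nlinarith
  have h2 : (-1 : ℝ) < n := by nlinarith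
  have h1' : n < 1 := by exact_mod_cast h1
  have h2' : -1 < n := by exact_mod_cast h2
  have : n = 0 := by omega
  exact h (by rw [hn, this]; simp)

theorem dslope_cexp_ne_zero {w w₀ : ℂ} (hw : |w.im| ≤ Real.pi) (hw₀ : |w₀.im| < Real.pi) :
    dslope Complex.exp w₀ w ≠ 0 := by
  rcases eq_or_ne w w₀ with rfl | h
  · rw [dslope_same, Complex.deriv_exp]; exact Complex.exp_ne_zero _
  · rw [dslope_of_ne _ h, slope_def_field]
    exact div_ne_zero (cexp_sub_ne_zero_of_mem_strip hw hw₀ h) (sub_ne_zero.2 h)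

/-- Cauchy's theorem on the rectangle `[a, b] × [-π, π]` for the function
`(N w - N w₀) e ^ w / (e ^ w - e ^ w₀)`. -/
theorem rectangle_integral_dslope_eq_zero {N : ℂ → ℂ} {a b : ℝ} {w₀ : ℂ} (ha : a < w₀.re)
    (hb : w₀.re < b) (hw₀ : |w₀.im| < Real.pi)
    (hc : ContinuousOn N {w | a ≤ w.re ∧ |w.im| ≤ Real.pi})
    (hd : DifferentiableOn ℂ N {w | a < w.re ∧ |w.im| < Real.pi}) :
    (∫ x in a..b, (N (x - Real.pi * Complex.I) - N (x + Real.pi * Complex.I)) *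
        (Complex.exp x / (Complex.exp x + Complex.exp w₀))) +
      Complex.I * (∫ y in (-Real.pi)..Real.pi, (N (b + y * Complex.I) - N w₀) *
        (Complex.exp (b + y * Complex.I) / (Complex.exp (b + y * Complex.I) - Complex.exp w₀))) -
      Complex.I * (∫ y in (-Real.pi)..Real.pi, (N (a + y * Complex.I) - N w₀) *
        (Complex.exp (a + y * Complex.I) / (Complex.exp (a + y * Complex.I) - Complex.exp w₀))) =
      0 := by
  have hpi := Real.pi_pos
  have hab : a ≤ b := (ha.trans hb).le
  have hpi' : -Real.pi ≤ Real.pi := by linarith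
  set R : Set ℂ := Icc a b ×ℂ Icc (-Real.pi) Real.pi with hR
  set U : Set ℂ := Ioo a b ×ℂ Ioo (-Real.pi) Real.pi with hU
  have hUo : IsOpen U := isOpen_Ioo.reProdIm isOpen_Ioo
  have hw₀U : w₀ ∈ U := by
    rw [hU, Complex.mem_reProdIm]; exact ⟨⟨ha, hb⟩, abs_lt.1 hw₀⟩
  have hUn : U ∈ 𝓝 w₀ := hUo.mem_nhds hw₀U
  have hUR : U ⊆ R := Complex.reProdIm_subset_iff.2 (prod_mono Ioo_subset_Icc_self Ioo_subset_Icc_self)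
  have hRim : ∀ w ∈ R, |w.im| ≤ Real.pi := fun w hw => abs_le.2 hw.2
  have hcR : ContinuousOn N R := hc.mono fun w hw => ⟨hw.1.1, hRim w hw⟩
  have hdU : DifferentiableOn ℂ N U := hd.mono fun w hw => ⟨hw.1.1, abs_lt.2 hw.2⟩
  -- The quotient of difference quotients fills in the singularity at `w₀`: both are holomorphic
  -- there and the denominator has no zero in the closed strip.
  set P : ℂ → ℂ := fun w => dslope N w₀ w / dslope Complex.exp w₀ w * Complex.exp w with hP
  have hPne : ∀ w, |w.im| ≤ Real.pi → w ≠ w₀ →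
      P w = (N w - N w₀) * (Complex.exp w / (Complex.exp w - Complex.exp w₀)) := by
    intro w hw h
    have h1 := cexp_sub_ne_zero_of_mem_strip hw hw₀ h
    have h2 := sub_ne_zero.2 h
    simp only [hP, dslope_of_ne _ h, slope_def_field]
    field_simp
  have hPc : ContinuousOn P R := by
    refine ContinuousOn.mul (ContinuousOn.div ?_ ?_ ?_) (by fun_prop)
    · exact (continuousOn_dslope (mem_of_superset hUn hUR)).2
        ⟨hcR, hdU.differentiableAt hUn⟩
    · exact (continuousOn_dslope (mem_of_superset hUn hUR)).2
        ⟨by fun_prop, Complex.differentiableAt_exp⟩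
    · intro w hw
      exact dslope_cexp_ne_zero (hRim w hw) hw₀
  have hPd : DifferentiableOn ℂ P U := by
    refine DifferentiableOn.mul (DifferentiableOn.div ?_ ?_ ?_) (by fun_prop)
    · exact (Complex.differentiableOn_dslope hUn).2 hdU
    · exact (Complex.differentiableOn_dslope hUn).2 (by fun_prop)
    · intro w hw
      exact dslope_cexp_ne_zero (hRim w (hUR hw)) hw₀
  have key := Complex.integral_boundary_rect_eq_zero_of_continuousOn_of_differentiableOn P
    (⟨a, -Real.pi⟩ : ℂ) (⟨b, Real.pi⟩ : ℂ)
    (by simpa only [uIcc_of_le hab, uIcc_of_le hpi'] using hPc)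
    (by simpa only [min_eq_left hab, max_eq_right hab, min_eq_left hpi', max_eq_right hpi']
          using hPd)
  simp only [smul_eq_mul] at key
  have hpe : ∀ x : ℝ, Complex.exp (x + Real.pi * Complex.I) = -Complex.exp x := by
    intro x; rw [Complex.exp_add, Complex.exp_pi_mul_I]; ring
  have hme : ∀ x : ℝ, Complex.exp (x - Real.pi * Complex.I) = -Complex.exp x := by
    intro x; rw [Complex.exp_sub, Complex.exp_pi_mul_I]; ring
  have hneg : ∀ x : ℝ, -Complex.exp x / (-Complex.exp x - Complex.exp w₀) =
      Complex.exp x / (Complex.exp x + Complex.exp w₀) := by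
    intro x
    rw [← neg_add', neg_div_neg_eq]
  have himne : ∀ {w : ℂ}, |w.im| = Real.pi → w ≠ w₀ := by
    rintro w hw rfl; exact hw₀.ne hw
  have e1 : ∀ x : ℝ, P (x + (-Real.pi : ℝ) * Complex.I) =
      (N (x - Real.pi * Complex.I) - N w₀) *
        (Complex.exp x / (Complex.exp x + Complex.exp w₀)) := by
    intro x
    have hh : (x : ℂ) + (-Real.pi : ℝ) * Complex.I = x - Real.pi * Complex.I := by push_cast; ring
    have him : |((x : ℂ) - Real.pi * Complex.I).im| = Real.pi := by simp [hpi.le]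
    rw [hh, hPne _ him.le (himne him), hme, hneg]
  have e2 : ∀ x : ℝ, P (x + Real.pi * Complex.I) =
      (N (x + Real.pi * Complex.I) - N w₀) *
        (Complex.exp x / (Complex.exp x + Complex.exp w₀)) := by
    intro x
    have him : |((x : ℂ) + Real.pi * Complex.I).im| = Real.pi := by simp [hpi.le]
    rw [hPne _ him.le (himne him), hpe, hneg]
  have e3 : ∀ c : ℝ, c ≠ w₀.re → ∫ y in (-Real.pi)..Real.pi, P (c + y * Complex.I) =
      ∫ y in (-Real.pi)..Real.pi, (N (c + y * Complex.I) - N w₀) *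
        (Complex.exp (c + y * Complex.I) / (Complex.exp (c + y * Complex.I) - Complex.exp w₀)) := by
    intro c hcne
    refine intervalIntegral.integral_congr fun y hy => ?_
    rw [uIcc_of_le hpi'] at hy
    refine hPne _ (by simpa using abs_le.2 hy) ?_
    intro h
    apply hcne
    rw [← h]; simp
  rw [e3 b hb.ne', e3 a ha.ne, ← intervalIntegral.integral_sub] at key
  · have e4 : ∀ x : ℝ, P (x + (-Real.pi : ℝ) * Complex.I) - P (x + Real.pi * Complex.I) =
        (N (x - Real.pi * Complex.I) - N (x + Real.pi * Complex.I)) *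
          (Complex.exp x / (Complex.exp x + Complex.exp w₀)) := by
      intro x
      rw [e1, e2]
      ring
    simp only [e4] at key
    exact key
  · refine ContinuousOn.intervalIntegrable ?_
    rw [uIcc_of_le hab]
    refine hPc.comp (by fun_prop) fun x hx => ?_
    rw [hR, Complex.mem_reProdIm]
    simpa [hpi.le] using hx
  · refine ContinuousOn.intervalIntegrable ?_
    rw [uIcc_of_le hab]
    refine hPc.comp (by fun_prop) fun x hx => ?_
    rw [hR, Complex.mem_reProdIm]
    simpa [hpi.le] using hx

theorem norm_cexp_div_le_one (x : ℝ) {l : ℂ} (hl : 0 < l.re) :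
    ‖Complex.exp x / (Complex.exp x + l)‖ ≤ 1 := by
  rw [norm_div]
  refine div_le_one_of_le₀ ?_ (norm_nonneg _)
  refine le_trans ?_ (Complex.re_le_norm _)
  rw [← Complex.ofReal_exp, Complex.norm_real, Real.norm_eq_abs, abs_of_pos (Real.exp_pos _),
    Complex.add_re, Complex.ofReal_re]
  linarith

/-- Cauchy's formula for the keyhole region outside the circle of radius `e ^ a`, in logarithmic
coordinates. -/
theorem keyhole_cauchy_formula {N : ℂ → ℂ} {a C : ℝ} {l : ℂ} (hl : 0 < l.re)
    (ha : Real.exp a < ‖l‖)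
    (hc : ContinuousOn N {w | a ≤ w.re ∧ |w.im| ≤ Real.pi})
    (hd : DifferentiableOn ℂ N {w | a < w.re ∧ |w.im| < Real.pi})
    (hC : ∀ w : ℂ, a ≤ w.re → |w.im| ≤ Real.pi → ‖N w‖ ≤ C * Real.exp (-w.re)) :
    IntegrableOn (fun x : ℝ => (N (x - Real.pi * Complex.I) - N (x + Real.pi * Complex.I)) *
        (Complex.exp x / (Complex.exp x + l))) (Ioi a) ∧
    2 * Real.pi * Complex.I * N (Complex.log l) =
      (∫ x in Ioi a, (N (x - Real.pi * Complex.I) - N (x + Real.pi * Complex.I)) *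
        (Complex.exp x / (Complex.exp x + l))) +
      Complex.I * ∫ y in (-Real.pi)..Real.pi, N (a + y * Complex.I) *
        (Complex.exp (a + y * Complex.I) / (l - Complex.exp (a + y * Complex.I))) := by
  have hpi := Real.pi_pos
  have hpi' : -Real.pi ≤ Real.pi := by linarith
  have hl0 : l ≠ 0 := by rintro rfl; simp at hl
  set w₀ := Complex.log l with hw₀
  have hexp : Complex.exp w₀ = l := Complex.exp_log hl0
  have hre : w₀.re = Real.log ‖l‖ := Complex.log_re l
  have ha' : a < w₀.re := by rw [hre]; exact (Real.lt_log_iff_exp_lt (norm_pos_iff.2 hl0)).2 ha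
  have him : |w₀.im| < Real.pi := by
    rw [hw₀, Complex.log_im]
    exact (Complex.abs_arg_lt_pi_div_two_iff.2 (Or.inl hl)).trans (by linarith)
  have hsm : ∀ x : ℝ, ((x : ℂ) - Real.pi * Complex.I).re = x ∧
      |((x : ℂ) - Real.pi * Complex.I).im| ≤ Real.pi := by intro x; simp [abs_of_pos hpi]
  have hsp : ∀ x : ℝ, ((x : ℂ) + Real.pi * Complex.I).re = x ∧
      |((x : ℂ) + Real.pi * Complex.I).im| ≤ Real.pi := by intro x; simp [abs_of_pos hpi]
  have hden : ∀ x : ℝ, Complex.exp x + l ≠ 0 := by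
    intro x h
    have := congrArg Complex.re h
    rw [← Complex.ofReal_exp] at this
    simp only [Complex.add_re, Complex.ofReal_re, Complex.zero_re] at this
    linarith [Real.exp_pos x]
  have hint : IntegrableOn (fun x : ℝ => (N (x - Real.pi * Complex.I) -
      N (x + Real.pi * Complex.I)) * (Complex.exp x / (Complex.exp x + l))) (Ioi a) := by
    refine Integrable.mono' (g := fun x => 2 * C * Real.exp (-1 * x)) ?_ ?_ ?_
    · exact (integrableOn_exp_mul_Ioi (by norm_num) a).const_mul _
    · refine ContinuousOn.aestronglyMeasurable ?_ measurableSet_Ioi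
      refine ContinuousOn.mul (ContinuousOn.sub ?_ ?_) (Continuous.continuousOn ?_)
      · exact hc.comp (by fun_prop) fun x hx => ⟨by rw [(hsm x).1]; exact le_of_lt hx, (hsm x).2⟩
      · exact hc.comp (by fun_prop) fun x hx => ⟨by rw [(hsp x).1]; exact le_of_lt hx, (hsp x).2⟩
      · exact Continuous.div (by fun_prop) (by fun_prop) hden
    · filter_upwards [ae_restrict_mem measurableSet_Ioi] with x hx
      have h1 := hC _ (by rw [(hsm x).1]; exact le_of_lt hx) (hsm x).2
      have h2 := hC _ (by rw [(hsp x).1]; exact le_of_lt hx) (hsp x).2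
      rw [(hsm x).1] at h1
      rw [(hsp x).1] at h2
      rw [norm_mul]
      refine (mul_le_of_le_one_right (norm_nonneg _) (norm_cexp_div_le_one x hl)).trans ?_
      refine (norm_sub_le _ _).trans ?_
      rw [neg_one_mul]
      linarith
  refine ⟨hint, ?_⟩
  have hNc : ∀ c : ℝ, a ≤ c → ContinuousOn (fun y : ℝ => N (c + y * Complex.I))
      (Icc (-Real.pi) Real.pi) := by
    intro c hac
    refine hc.comp (by fun_prop) fun y hy => ?_
    simpa using ⟨hac, abs_le.2 hy⟩
  have hEc : ∀ c : ℝ, c ≠ w₀.re → ContinuousOn (fun y : ℝ => Complex.exp (c + y * Complex.I) /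
      (Complex.exp (c + y * Complex.I) - l)) (Icc (-Real.pi) Real.pi) := by
    intro c hcne
    refine ContinuousOn.div (by fun_prop) (by fun_prop) fun y hy => ?_
    rw [← hexp]
    refine cexp_sub_ne_zero_of_mem_strip (by simpa using abs_le.2 hy) him fun h => hcne ?_
    rw [← h]; simp
  have hsplit : ∀ c : ℝ, a ≤ c → c ≠ w₀.re →
      ∫ y in (-Real.pi)..Real.pi, (N (c + y * Complex.I) - N w₀) *
        (Complex.exp (c + y * Complex.I) / (Complex.exp (c + y * Complex.I) - l)) =
      (∫ y in (-Real.pi)..Real.pi, N (c + y * Complex.I) *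
        (Complex.exp (c + y * Complex.I) / (Complex.exp (c + y * Complex.I) - l))) -
      N w₀ * ∫ y in (-Real.pi)..Real.pi,
        (Complex.exp (c + y * Complex.I) / (Complex.exp (c + y * Complex.I) - l)) := by
    intro c hac hcne
    rw [← intervalIntegral.integral_const_mul, ← intervalIntegral.integral_sub]
    · simp only [sub_mul]
    · refine ContinuousOn.intervalIntegrable ?_
      rw [uIcc_of_le hpi']
      exact (hNc c hac).mul (hEc c hcne)
    · refine ContinuousOn.intervalIntegrable ?_
      rw [uIcc_of_le hpi']
      exact continuousOn_const.mul (hEc c hcne)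
  -- Subtracting `N w₀` to cancel the pole costs `N w₀` times the winding integral on each vertical
  -- side: `0` on the inner circle, which leaves `l` outside, and `2πi` on the outer one.
  have hca : ∮ z in C(0, Real.exp a), (z - l)⁻¹ = 0 := by
    refine Complex.circleIntegral_eq_zero_of_differentiable_on_off_countable (Real.exp_pos a).le
      countable_empty ?_ ?_
    · refine ContinuousOn.inv₀ (by fun_prop) fun z hz => ?_
      rw [sub_ne_zero]
      rintro rfl
      rw [mem_closedBall_zero_iff] at hz
      linarith
    · rintro z ⟨hz, -⟩
      refine DifferentiableAt.inv (by fun_prop) ?_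
      rw [sub_ne_zero]
      rintro rfl
      rw [mem_ball_zero_iff] at hz
      linarith
  have hfin : ∀ b : ℝ, w₀.re < b → (∫ x in a..b,
      (N (x - Real.pi * Complex.I) - N (x + Real.pi * Complex.I)) *
        (Complex.exp x / (Complex.exp x + l))) =
      2 * Real.pi * Complex.I * N w₀ - Complex.I * (∫ y in (-Real.pi)..Real.pi,
        N (b + y * Complex.I) *
        (Complex.exp (b + y * Complex.I) / (Complex.exp (b + y * Complex.I) - l))) +
      Complex.I * ∫ y in (-Real.pi)..Real.pi, N (a + y * Complex.I) *
        (Complex.exp (a + y * Complex.I) / (Complex.exp (a + y * Complex.I) - l)) := by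
    intro b hb
    have key := rectangle_integral_dslope_eq_zero ha' hb him hc hd
    rw [hexp, hsplit b (ha'.trans hb).le hb.ne', hsplit a le_rfl ha'.ne] at key
    have hcb : ∮ z in C(0, Real.exp b), (z - l)⁻¹ = 2 * Real.pi * Complex.I := by
      refine circleIntegral.integral_sub_inv_of_mem_ball ?_
      rw [mem_ball_zero_iff]
      rw [hre] at hb
      exact (Real.log_lt_iff_lt_exp (norm_pos_iff.2 hl0)).1 hb
    rw [← integral_cexp_div_eq_circleIntegral] at hca hcb
    linear_combination key + N w₀ * hcb - N w₀ * hca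
  -- The kernel is at most `e^b / (e^b - |l|)`, which stays bounded, while `N` decays like `e^{-b}`:
  -- the outer circle disappears.
  have hlim0 : Tendsto (fun b : ℝ => ∫ y in (-Real.pi)..Real.pi, N (b + y * Complex.I) *
        (Complex.exp (b + y * Complex.I) / (Complex.exp (b + y * Complex.I) - l))) atTop
        (𝓝 0) := by
    have hb0 : Tendsto (fun b : ℝ => C * (1 / (Real.exp b - ‖l‖)) * |Real.pi - -Real.pi|) atTop
        (𝓝 0) := by
      have : Tendsto (fun b : ℝ => Real.exp b - ‖l‖) atTop atTop :=
        tendsto_atTop_add_const_right _ _ Real.tendsto_exp_atTop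
      have := (this.inv_tendsto_atTop.const_mul C).mul_const (|Real.pi - -Real.pi|)
      simpa [one_div] using this
    refine squeeze_zero_norm' ?_ hb0
    filter_upwards [eventually_gt_atTop w₀.re] with b hb
    have hbl : ‖l‖ < Real.exp b := by
      rw [hre] at hb
      exact (Real.log_lt_iff_lt_exp (norm_pos_iff.2 hl0)).1 hb
    refine intervalIntegral.norm_integral_le_of_norm_le_const fun y hy => ?_
    rw [uIoc_of_le hpi'] at hy
    have hn : ‖Complex.exp (b + y * Complex.I)‖ = Real.exp b := by
      rw [Complex.norm_exp]; simp
    have h1 := hC (b + y * Complex.I) (by simpa using (ha'.trans hb).le)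
      (by simpa using abs_le.2 ⟨hy.1.le, hy.2⟩)
    have h2 : Real.exp b - ‖l‖ ≤ ‖Complex.exp (b + y * Complex.I) - l‖ := by
      rw [← hn]; exact norm_sub_norm_le _ _
    have h3 : 0 < Real.exp b - ‖l‖ := by linarith
    have hre' : ((b : ℂ) + y * Complex.I).re = b := by simp
    rw [hre'] at h1
    have hC0 : 0 ≤ C * Real.exp (-b) := (norm_nonneg _).trans h1
    rw [norm_mul, norm_div, hn]
    calc _ ≤ C * Real.exp (-b) * (Real.exp b / (Real.exp b - ‖l‖)) := by gcongr
      _ = _ := by rw [Real.exp_neg]; field_simp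
  have hlim1 := intervalIntegral_tendsto_integral_Ioi a hint tendsto_id
  have hlim2 := ((hlim0.const_mul Complex.I).const_sub (2 * Real.pi * Complex.I * N w₀)).add_const
    (Complex.I * ∫ y in (-Real.pi)..Real.pi, N (a + y * Complex.I) *
        (Complex.exp (a + y * Complex.I) / (Complex.exp (a + y * Complex.I) - l)))
  have heq := tendsto_nhds_unique (hlim1.congr' (by
    filter_upwards [eventually_gt_atTop w₀.re] with b hb
    exact hfin b hb)) hlim2
  rw [heq]
  have hneg : ∀ y : ℝ, N (a + y * Complex.I) *
        (Complex.exp (a + y * Complex.I) / (l - Complex.exp (a + y * Complex.I))) =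
      -(N (a + y * Complex.I) *
        (Complex.exp (a + y * Complex.I) / (Complex.exp (a + y * Complex.I) - l))) := by
    intro y
    rw [← neg_sub l, div_neg]
    ring
  simp only [hneg, intervalIntegral.integral_neg]
  ring

/-! ### Boundary values on the two edges of the cut -/

/-- The function `w ↦ G (e ^ w)` on the strip `0 ≤ Im w ≤ π`, extended by conjugation symmetry to
`-π ≤ Im w ≤ π`. -/
noncomputable def stripLift (G : ℂ → ℂ) (w : ℂ) : ℂ :=
  if 0 ≤ w.im then G (Complex.exp w) else conj (G (Complex.exp (conj w)))

theorem cexp_im_nonneg {w : ℂ} (h0 : 0 ≤ w.im) (h1 : w.im ≤ Real.pi) :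
    0 ≤ (Complex.exp w).im := by
  rw [Complex.exp_im]
  exact mul_nonneg (Real.exp_pos _).le (Real.sin_nonneg_of_nonneg_of_le_pi h0 h1)

theorem cexp_mem_slitPlane {w : ℂ} (h : |w.im| < Real.pi) : Complex.exp w ∈ Complex.slitPlane := by
  rw [abs_lt] at h
  rw [Complex.mem_slitPlane_iff_arg, ← Complex.log_im, Complex.log_exp h.1 h.2.le]
  exact ⟨h.2.ne, Complex.exp_ne_zero _⟩

/-- Conjugation symmetry of `F` makes the two branches agree with one holomorphic function, so no
seam appears on the real axis. -/
theorem stripLift_eq {F G : ℂ → ℂ}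
    (hGF : ∀ z ∈ Complex.slitPlane, 0 ≤ z.im → G z = F z)
    (hF : ∀ z ∈ Complex.slitPlane, F (conj z) = conj (F z)) {w : ℂ} (h : |w.im| < Real.pi) :
    stripLift G w = F (Complex.exp w) := by
  have h' := abs_lt.1 h
  rw [stripLift]
  split_ifs with h0
  · exact hGF _ (cexp_mem_slitPlane h) (cexp_im_nonneg h0 h'.2.le)
  · have h1 : |(conj w).im| < Real.pi := by simpa using h
    rw [hGF _ (cexp_mem_slitPlane h1), ← hF _ (cexp_mem_slitPlane h1), ← Complex.exp_conj,
      Complex.conj_conj]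
    refine cexp_im_nonneg ?_ ?_ <;> rw [Complex.conj_im] <;> linarith

theorem differentiableOn_stripLift {F G : ℂ → ℂ}
    (hGF : ∀ z ∈ Complex.slitPlane, 0 ≤ z.im → G z = F z)
    (hF : ∀ z ∈ Complex.slitPlane, F (conj z) = conj (F z))
    (hFd : DifferentiableOn ℂ F Complex.slitPlane) :
    DifferentiableOn ℂ (stripLift G) {w | |w.im| < Real.pi} := by
  refine DifferentiableOn.congr (f := fun w => F (Complex.exp w)) ?_
    fun w hw => stripLift_eq hGF hF hw
  exact hFd.comp (by fun_prop) fun w hw => cexp_mem_slitPlane hw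

/-- Inside the strip the lift is holomorphic; near either edge only one branch of the definition is
active, and there it inherits continuity from `G` on the closed half-plane. -/
theorem continuousOn_stripLift {F G : ℂ → ℂ}
    (hGF : ∀ z ∈ Complex.slitPlane, 0 ≤ z.im → G z = F z)
    (hF : ∀ z ∈ Complex.slitPlane, F (conj z) = conj (F z))
    (hFd : DifferentiableOn ℂ F Complex.slitPlane) (hG : ContinuousOn G {z | 0 ≤ z.im}) :
    ContinuousOn (stripLift G) {w | |w.im| ≤ Real.pi} := by
  have hpi := Real.pi_pos
  intro w hw
  rcases lt_or_eq_of_le (show |w.im| ≤ Real.pi from hw) with h | h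
  · refine ContinuousAt.continuousWithinAt ?_
    refine ((differentiableOn_stripLift hGF hF hFd).differentiableAt ?_).continuousAt
    exact (isOpen_lt (by fun_prop) continuous_const).mem_nhds h
  · have hup : ContinuousOn (fun w => G (Complex.exp w)) {w | 0 ≤ w.im ∧ w.im ≤ Real.pi} :=
      hG.comp (by fun_prop) fun w hw => cexp_im_nonneg hw.1 hw.2
    rcases (eq_or_eq_neg_of_abs_eq h) with h | h
    · have hn : {w : ℂ | 0 < w.im} ∈ 𝓝 w :=
        (isOpen_lt continuous_const Complex.continuous_im).mem_nhds (by
          rw [mem_ofPred_eq, h]; exact hpi)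
      rw [← continuousWithinAt_inter hn]
      refine ContinuousWithinAt.congr (f := fun w => G (Complex.exp w)) ?_ ?_ ?_
      · refine (hup w ⟨by rw [h]; exact hpi.le, h.le⟩).mono ?_
        rintro v ⟨h1, h2⟩
        exact ⟨le_of_lt h2, (abs_le.1 h1).2⟩
      · rintro v ⟨_, h2⟩
        exact if_pos (le_of_lt h2)
      · exact if_pos (by rw [h]; exact hpi.le)
    · have hn : {w : ℂ | w.im < 0} ∈ 𝓝 w :=
        (isOpen_lt Complex.continuous_im continuous_const).mem_nhds (by
          rw [mem_ofPred_eq, h]; linarith)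
      have hlow : ContinuousOn (fun w => conj (G (Complex.exp (conj w))))
          {w | -Real.pi ≤ w.im ∧ w.im ≤ 0} := by
        refine Complex.continuous_conj.comp_continuousOn
          (hup.comp Complex.continuous_conj.continuousOn fun w hw => ?_)
        simp only [mem_ofPred_eq, Complex.conj_im] at *
        constructor <;> linarith
      rw [← continuousWithinAt_inter hn]
      refine ContinuousWithinAt.congr (f := fun w => conj (G (Complex.exp (conj w)))) ?_ ?_ ?_
      · refine (hlow w ⟨h.ge, by rw [h]; linarith⟩).mono ?_
        rintro v ⟨h1, h2⟩
        exact ⟨(abs_le.1 h1).1, le_of_lt h2⟩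
      · rintro v ⟨_, h2⟩
        exact if_neg (not_le.2 h2)
      · exact if_neg (by rw [h]; linarith)

theorem stripLift_add_pi (G : ℂ → ℂ) (x : ℝ) :
    stripLift G (x + Real.pi * Complex.I) = G (-Complex.exp x) := by
  have hpi := Real.pi_pos
  rw [stripLift, if_pos (by simpa using hpi.le), Complex.exp_add, Complex.exp_pi_mul_I, mul_neg_one]

theorem stripLift_sub_pi (G : ℂ → ℂ) (x : ℝ) :
    stripLift G (x - Real.pi * Complex.I) = conj (G (-Complex.exp x)) := by
  have hpi := Real.pi_pos
  rw [stripLift, if_neg (by simpa using hpi)]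
  simp only [map_sub, map_mul, Complex.conj_ofReal, Complex.conj_I, mul_neg, sub_neg_eq_add]
  rw [Complex.exp_add, Complex.exp_pi_mul_I, mul_neg_one]

theorem norm_stripLift_le {G : ℂ → ℂ} {ε C : ℝ}
    (hC : ∀ z : ℂ, ε ≤ ‖z‖ → 0 ≤ z.im → ‖G z‖ ≤ C * ‖z‖) {w : ℂ} (h1 : |w.im| ≤ Real.pi)
    (h2 : ε ≤ Real.exp w.re) : ‖stripLift G w‖ ≤ C * Real.exp w.re := by
  have h1' := abs_le.1 h1
  rw [stripLift]
  split_ifs with h0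
  · have := hC (Complex.exp w) (by rwa [Complex.norm_exp]) (cexp_im_nonneg h0 h1'.2)
    rwa [Complex.norm_exp] at this
  · have := hC (Complex.exp (conj w)) (by rwa [Complex.norm_exp, Complex.conj_re])
      (by apply cexp_im_nonneg <;> rw [Complex.conj_im] <;> linarith)
    rwa [Complex.norm_exp, Complex.conj_re, ← Complex.norm_conj] at this

/-! ### Growth at infinity and symmetry of the continuation -/

/-- A function that is continuous on the closed upper half-plane and `o(z)` at infinity there is
`O(z)` away from the origin. -/
theorem exists_norm_le_mul_norm {G : ℂ → ℂ} (hG : ContinuousOn G {z | 0 ≤ z.im})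
    (hlim : Tendsto (fun z : ℂ => G z / z) (Bornology.cobounded ℂ ⊓ 𝓟 {z : ℂ | 0 ≤ z.im}) (𝓝 0))
    {ε : ℝ} (hε : 0 < ε) : ∃ C, ∀ z : ℂ, ε ≤ ‖z‖ → 0 ≤ z.im → ‖G z‖ ≤ C * ‖z‖ := by
  have h1 : ∀ᶠ z in Bornology.cobounded ℂ, 0 ≤ z.im → ‖G z / z‖ < 1 := by
    have := hlim.norm.eventually (Iio_mem_nhds (show ‖(0 : ℂ)‖ < 1 by simp))
    exact eventually_inf_principal.1 this
  obtain ⟨R, -, hR⟩ := (Metric.hasBasis_cobounded_compl_closedBall (0 : ℂ)).eventually_iff.1 h1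
  -- Beyond radius `R` the quotient is below `1`; the remaining half-annulus is compact and avoids
  -- the origin.
  have hK : IsCompact (Metric.closedBall (0 : ℂ) R ∩ {z | ε ≤ ‖z‖ ∧ 0 ≤ z.im}) := by
    refine (isCompact_closedBall _ _).inter_right ?_
    exact (isClosed_le continuous_const continuous_norm).inter
      (isClosed_le continuous_const Complex.continuous_im)
  obtain ⟨C, hC⟩ := hK.exists_bound_of_continuousOn (f := fun z => G z / z) (by
    refine ContinuousOn.div (hG.mono fun z hz => hz.2.2) continuousOn_id fun z hz h0 => ?_
    have : ε ≤ ‖z‖ := hz.2.1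
    rw [show z = 0 from h0, norm_zero] at this
    linarith)
  refine ⟨max C 1, fun z hz him => ?_⟩
  have hz0 : 0 < ‖z‖ := hε.trans_le hz
  rw [← div_le_iff₀ hz0, ← norm_div]
  by_cases h : z ∈ Metric.closedBall (0 : ℂ) R
  · exact (hC z ⟨h, hz, him⟩).trans (le_max_left _ _)
  · exact (hR h him).le.trans (le_max_right _ _)

namespace BernsteinFunction

theorem eval_conj (B : BernsteinFunction) (z : ℂ) : B.eval (conj z) = conj (B.eval z) := by
  simp only [eval, map_add, map_mul, Complex.conj_ofReal, ← integral_conj, map_sub, map_one,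
    ← Complex.exp_conj, map_neg]

/-- The Lévy–Khintchine formula has real data, so the symmetry holds on the right half-plane; the
identity theorem carries it to the connected slit plane. -/
theorem IsContinuation.apply_conj {B : BernsteinFunction} {Φ : ℂ → ℂ} (hΦ : B.IsContinuation Φ)
    {z : ℂ} (hz : z ∈ Complex.slitPlane) : Φ (conj z) = conj (Φ z) := by
  have hconj : ∀ z ∈ Complex.slitPlane, conj z ∈ Complex.slitPlane := by
    intro z hz
    rw [Complex.mem_slitPlane_iff] at *
    simpa using hz
  have hd : DifferentiableOn ℂ (conj ∘ Φ ∘ conj) Complex.slitPlane := by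
    intro z hz
    have h1 := hΦ.1.differentiableAt (Complex.isOpen_slitPlane.mem_nhds (hconj z hz))
    have h2 := h1.conj_conj
    rw [Complex.conj_conj] at h2
    exact h2.differentiableWithinAt
  have heq : EqOn Φ (conj ∘ Φ ∘ conj) Complex.slitPlane := by
    refine AnalyticOnNhd.eqOn_of_preconnected_of_eventuallyEq
      (hΦ.1.analyticOnNhd Complex.isOpen_slitPlane) (hd.analyticOnNhd Complex.isOpen_slitPlane)
      ?_ Complex.one_mem_slitPlane ?_
    · exact (Complex.starConvex_one_slitPlane.isPathConnected
        Complex.one_mem_slitPlane).isConnected.isPreconnected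
    · have : {z : ℂ | 0 < z.re} ∈ 𝓝 (1 : ℂ) :=
        (isOpen_lt continuous_const Complex.continuous_re).mem_nhds (by simp)
      filter_upwards [this] with z hz
      simp only [Function.comp_apply]
      rw [hΦ.2 z hz, hΦ.2 (conj z) (by simpa using hz), eval_conj, Complex.conj_conj]
  rw [heq hz]
  simp

theorem IsContinuation.dagger_conj {B : BernsteinFunction} {Φ : ℂ → ℂ} (hΦ : B.IsContinuation Φ)
    (z : ℂ) (hz : z ∈ Complex.slitPlane) : B.dagger Φ (conj z) = conj (B.dagger Φ z) := by
  simp only [dagger, hΦ.apply_conj hz, map_sub, map_mul, Complex.conj_ofReal]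

theorem IsContinuation.differentiableOn_dagger {B : BernsteinFunction} {Φ : ℂ → ℂ}
    (hΦ : B.IsContinuation Φ) : DifferentiableOn ℂ (B.dagger Φ) Complex.slitPlane :=
  (hΦ.1.sub_const _).sub (by fun_prop)

theorem continuousOn_dagger {B : BernsteinFunction} {F : ℂ → ℂ} {s : Set ℂ}
    (hF : ContinuousOn F s) : ContinuousOn (B.dagger F) s :=
  (hF.sub continuousOn_const).sub (by fun_prop)

end BernsteinFunction

/-- The extension is prescribed only off the real line. On the positive half-axis both functions are
limits from the open upper half-plane, hence equal. -/
theorem IsUpperExtension.eq_of_mem_slitPlane {Φ Φp : ℂ → ℂ} (h : IsUpperExtension Φ Φp)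
    (hΦ : ContinuousOn Φ Complex.slitPlane) {z : ℂ} (hz : z ∈ Complex.slitPlane)
    (him : 0 ≤ z.im) : Φp z = Φ z := by
  have hcl : z ∈ closure {v : ℂ | 0 < v.im} := by
    rw [Complex.closure_setOfPred_lt_im]; exact him
  have := mem_closure_iff_nhdsWithin_neBot.1 hcl
  have h1 : Tendsto Φp (𝓝[{v : ℂ | 0 < v.im}] z) (𝓝 (Φp z)) :=
    (h.1 z him).mono_left (nhdsWithin_mono _ fun v (hv : 0 < v.im) => hv.le)
  have h2 : Tendsto Φ (𝓝[{v : ℂ | 0 < v.im}] z) (𝓝 (Φ z)) :=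
    (hΦ.continuousAt (Complex.isOpen_slitPlane.mem_nhds hz)).mono_left nhdsWithin_le_nhds
  refine tendsto_nhds_unique (h1.congr' ?_) h2
  filter_upwards [self_mem_nhdsWithin] with v hv
  exact h.2 v hv

/-! ### The Hankel integral and its Laplace transform -/

/-- The density on the two sides of the cut in the Hankel representation of the primitive. -/
noncomputable def rayKernel (G : ℂ → ℂ) (n : ℕ) (ρ : ℝ) : ℝ :=
  (-1) ^ n * (G (-(ρ : ℂ)) ^ n).im / ρ ^ (n + 1)

/-- The density on the circle of radius `ε` in the Hankel representation of the primitive. -/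
noncomputable def circleKernel (G : ℂ → ℂ) (n : ℕ) (ε y : ℝ) : ℂ :=
  Complex.I * (stripLift G (Real.log ε + y * Complex.I) ^ n /
    Complex.exp (Real.log ε + y * Complex.I) ^ n)

/-- The Hankel contour integral `1 / (2 π i) ∫ z ^ j e ^ {t z} G(z) ^ n / z ^ {n + 1} dz`. -/
noncomputable def hankelIntegral (G : ℂ → ℂ) (n : ℕ) (ε : ℝ) (j : ℕ) (t : ℝ) : ℂ :=
  1 / (Real.pi : ℂ) * (∫ ρ in Ioi ε, (-(ρ : ℂ)) ^ j * Complex.exp (t * -(ρ : ℂ)) *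
      (rayKernel G n ρ : ℂ)) +
    1 / (2 * (Real.pi : ℂ) * Complex.I) * ∫ y in Ioc (-Real.pi) Real.pi,
      Complex.exp (Real.log ε + y * Complex.I) ^ j *
        Complex.exp (t * Complex.exp (Real.log ε + y * Complex.I)) * circleKernel G n ε y

theorem norm_rayKernel_le {G : ℂ → ℂ} {ε C : ℝ} (hε : 0 < ε)
    (hC : ∀ z : ℂ, ε ≤ ‖z‖ → 0 ≤ z.im → ‖G z‖ ≤ C * ‖z‖) (n : ℕ) {ρ : ℝ} (hρ : ε ≤ ρ) :
    ‖(rayKernel G n ρ : ℂ)‖ ≤ C ^ n / ρ := by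
  have hρ0 : 0 < ρ := hε.trans_le hρ
  have h := hC (-(ρ : ℂ)) (by simpa [abs_of_pos hρ0] using hρ) (by simp)
  rw [norm_neg, Complex.norm_real, Real.norm_eq_abs, abs_of_pos hρ0] at h
  rw [Complex.norm_real, rayKernel, norm_div, norm_mul, norm_pow, norm_neg, norm_one, one_pow,
    one_mul, norm_pow, Real.norm_eq_abs, Real.norm_eq_abs, abs_of_pos hρ0]
  have h2 : |(G (-(ρ : ℂ)) ^ n).im| ≤ (C * ρ) ^ n := by
    refine (Complex.abs_im_le_norm _).trans ?_
    rw [norm_pow]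
    gcongr
  calc _ ≤ (C * ρ) ^ n / ρ ^ (n + 1) := by gcongr
    _ = _ := by rw [mul_pow, pow_succ]; field_simp

theorem continuousOn_rayKernel {G : ℂ → ℂ} (hG : ContinuousOn G {z | 0 ≤ z.im}) (n : ℕ) :
    ContinuousOn (fun ρ => (rayKernel G n ρ : ℂ)) (Ioi 0) := by
  refine Complex.continuous_ofReal.comp_continuousOn ?_
  refine ContinuousOn.div (continuousOn_const.mul ?_) (by fun_prop) fun ρ hρ =>
    pow_ne_zero _ (ne_of_gt hρ)
  refine Complex.continuous_im.comp_continuousOn (ContinuousOn.pow ?_ n)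
  exact hG.comp (by fun_prop) fun ρ _ => by simp

theorem aestronglyMeasurable_rayKernel {G : ℂ → ℂ} (hG : ContinuousOn G {z | 0 ≤ z.im}) (n : ℕ)
    {ε : ℝ} (hε : 0 < ε) :
    AEStronglyMeasurable (fun ρ => (rayKernel G n ρ : ℂ)) (volume.restrict (Ioi ε)) :=
  ((continuousOn_rayKernel hG n).mono (Ioi_subset_Ioi hε.le)).aestronglyMeasurable measurableSet_Ioi

/-- The kernel is bounded on the ray, and `e^{-tρ}` absorbs every power of `ρ` because `t > 0`. -/
theorem integrable_ray {G : ℂ → ℂ} (hG : ContinuousOn G {z | 0 ≤ z.im}) {ε C : ℝ} (hε : 0 < ε)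
    (hC : ∀ z : ℂ, ε ≤ ‖z‖ → 0 ≤ z.im → ‖G z‖ ≤ C * ‖z‖) (n : ℕ) {t : ℝ} (ht : 0 < t) (k : ℕ) :
    Integrable (fun ρ : ℝ => (-(ρ : ℂ)) ^ k * Complex.exp (t * -(ρ : ℂ)) * (rayKernel G n ρ : ℂ))
      (volume.restrict (Ioi ε)) := by
  have h1 := integrableOn_rpow_mul_exp_neg_mul_rpow (p := 1) (s := k) (b := t)
    (by have : (0 : ℝ) ≤ k := k.cast_nonneg
        linarith) one_pos ht
  have h2 := (h1.mono_set (Ioi_subset_Ioi hε.le)).const_mul (C ^ n / ε)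
  refine h2.mono' ?_ ?_
  · refine AEStronglyMeasurable.mul (Continuous.aestronglyMeasurable (by fun_prop)) ?_
    exact aestronglyMeasurable_rayKernel hG n hε
  · filter_upwards [ae_restrict_mem measurableSet_Ioi] with ρ hρ
    rw [mem_Ioi] at hρ
    have hρ0 : 0 < ρ := hε.trans hρ
    have hk := norm_rayKernel_le hε hC n hρ.le
    have hC0 : 0 ≤ C ^ n := by
      have := (norm_nonneg _).trans hk
      rwa [le_div_iff₀ hρ0, zero_mul] at this
    rw [norm_mul, norm_mul, norm_pow, norm_neg, Complex.norm_real, Real.norm_eq_abs,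
      abs_of_pos hρ0, Complex.norm_exp, Real.rpow_one, Real.rpow_natCast, mul_comm]
    have he : ((t : ℂ) * -(ρ : ℂ)).re = -t * ρ := by simp
    rw [he]
    gcongr
    exact hk.trans (by gcongr)

theorem integrable_circleKernel_mul {G : ℂ → ℂ}
    (hS : ContinuousOn (stripLift G) {w | |w.im| ≤ Real.pi}) (n : ℕ) (ε : ℝ) {h : ℝ → ℂ}
    (hh : ContinuousOn h (Icc (-Real.pi) Real.pi)) :
    Integrable (fun y : ℝ => h y * circleKernel G n ε y)
      (volume.restrict (Ioc (-Real.pi) Real.pi)) := by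
  change IntegrableOn (fun y : ℝ => h y * circleKernel G n ε y) (Ioc (-Real.pi) Real.pi) volume
  rw [← integrableOn_Icc_iff_integrableOn_Ioc]
  refine ContinuousOn.integrableOn_Icc (hh.mul (continuousOn_const.mul (ContinuousOn.div ?_ ?_ ?_)))
  · refine ContinuousOn.pow (hS.comp (by fun_prop) fun y hy => ?_) n
    simpa using abs_le.2 hy
  · fun_prop
  · exact fun y _ => pow_ne_zero _ (Complex.exp_ne_zero _)

theorem hasDerivAt_hankelIntegral {G : ℂ → ℂ} (hG : ContinuousOn G {z | 0 ≤ z.im})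
    (hS : ContinuousOn (stripLift G) {w | |w.im| ≤ Real.pi}) {ε C : ℝ} (hε : 0 < ε)
    (hC : ∀ z : ℂ, ε ≤ ‖z‖ → 0 ≤ z.im → ‖G z‖ ≤ C * ‖z‖) (n j : ℕ) {t : ℝ} (ht : 0 < t) :
    HasDerivAt (hankelIntegral G n ε j) (hankelIntegral G n ε (j + 1) t) t := by
  refine HasDerivAt.add (HasDerivAt.const_mul _ ?_) (HasDerivAt.const_mul _ ?_)
  · exact hasDerivAt_integral_pow_mul_cexp (z := fun ρ : ℝ => -(ρ : ℂ))
      (a := fun ρ => (rayKernel G n ρ : ℂ)) (fun t ht k => integrable_ray hG hε hC n ht k) j ht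
  · exact hasDerivAt_integral_pow_mul_cexp
      (z := fun y : ℝ => Complex.exp (Real.log ε + y * Complex.I))
      (a := fun y => circleKernel G n ε y) (fun t ht k =>
        integrable_circleKernel_mul hS n ε (by fun_prop)) j ht

theorem integral_Ioi_comp_exp {E : Type*} [NormedAddCommGroup E] [NormedSpace ℝ E] (g : ℝ → E)
    {ε : ℝ} (hε : 0 < ε) :
    ∫ ρ in Ioi ε, g ρ = ∫ x in Ioi (Real.log ε), Real.exp x • g (Real.exp x) := by
  have him : Real.exp '' Ioi (Real.log ε) = Ioi ε := by
    ext ρ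
    simp only [mem_image, mem_Ioi]
    constructor
    · rintro ⟨x, hx, rfl⟩
      exact (Real.log_lt_iff_lt_exp hε).1 hx
    · intro hρ
      exact ⟨Real.log ρ, Real.log_lt_log hε hρ, Real.exp_log (hε.trans hρ)⟩
  rw [← him, integral_image_eq_integral_abs_deriv_smul measurableSet_Ioi
    (fun x _ => (Real.hasDerivAt_exp x).hasDerivWithinAt) Real.exp_injective.injOn]
  simp only [abs_of_pos (Real.exp_pos _)]

/-- The Laplace transform of the Hankel integral. -/
theorem hankelIntegral_laplace {F G : ℂ → ℂ}
    (hGF : ∀ z ∈ Complex.slitPlane, 0 ≤ z.im → G z = F z)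
    (hF : ∀ z ∈ Complex.slitPlane, F (conj z) = conj (F z))
    (hFd : DifferentiableOn ℂ F Complex.slitPlane) (hG : ContinuousOn G {z | 0 ≤ z.im})
    {ε C : ℝ} (hε : 0 < ε) (hC : ∀ z : ℂ, ε ≤ ‖z‖ → 0 ≤ z.im → ‖G z‖ ≤ C * ‖z‖) (n : ℕ)
    {l : ℂ} (hl : ε < l.re) :
    IntegrableOn (fun t : ℝ => Complex.exp (-(l * t)) * hankelIntegral G n ε 0 t) (Ioi 0) ∧
      ∫ t in Ioi (0 : ℝ), Complex.exp (-(l * t)) * hankelIntegral G n ε 0 t =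
        (F l / l) ^ n * (1 / l) := by
  have hpi := Real.pi_pos
  have hpi' : -Real.pi ≤ Real.pi := by linarith
  have hl0 : 0 < l.re := hε.trans hl
  have hlne : l ≠ 0 := by rintro rfl; simp at hl0
  have hS := continuousOn_stripLift hGF hF hFd hG
  have hSd := differentiableOn_stripLift hGF hF hFd
  set z : ℝ → ℂ := fun y => Complex.exp (Real.log ε + y * Complex.I) with hz
  -- On the circle `Re z ≤ ε < Re l`, which is why `l` is taken to the right of `ε`.
  have hzre : ∀ y, (z y).re < l.re := by
    intro y
    refine lt_of_le_of_lt (Complex.re_le_norm _) ?_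
    rw [hz, Complex.norm_exp]
    simpa [Real.exp_log hε] using hl
  have hzm : Measurable z := by fun_prop
  have hrm := aestronglyMeasurable_rayKernel hG n hε
  have hrl : ∀ᵐ ρ : ℝ ∂(volume.restrict (Ioi ε)), (-(ρ : ℂ)).re < l.re := by
    filter_upwards [ae_restrict_mem measurableSet_Ioi] with ρ hρ
    have : ε < ρ := hρ
    rw [Complex.neg_re, Complex.ofReal_re]
    linarith
  have hri : Integrable (fun ρ : ℝ => ‖(rayKernel G n ρ : ℂ)‖ / (l.re - (-(ρ : ℂ)).re))
      (volume.restrict (Ioi ε)) := by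
    -- One factor `1/ρ` is the gain from passing to the primitive, the other comes from `1/(Re l +
    -- ρ)`.
    have h1 : IntegrableOn (fun ρ : ℝ => C ^ n * ρ ^ (-2 : ℝ)) (Ioi ε) :=
      (integrableOn_Ioi_rpow_of_lt (by norm_num) hε).const_mul _
    refine h1.mono' ?_ ?_
    · exact (hrm.norm.aemeasurable.div (by fun_prop)).aestronglyMeasurable
    · filter_upwards [ae_restrict_mem measurableSet_Ioi] with ρ hρ
      rw [mem_Ioi] at hρ
      have hρ0 : 0 < ρ := hε.trans hρ
      have hk := norm_rayKernel_le hε hC n hρ.le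
      rw [Complex.neg_re, Complex.ofReal_re, sub_neg_eq_add, norm_div, norm_norm,
        Real.norm_eq_abs, abs_of_pos (by linarith : 0 < l.re + ρ)]
      calc _ ≤ (C ^ n / ρ) / ρ := by
            have := (norm_nonneg _).trans hk
            gcongr
            linarith
        _ = _ := by
            rw [Real.rpow_neg hρ0.le, Real.rpow_two, div_div, ← sq, div_eq_mul_inv]
  have hck : Integrable (circleKernel G n ε) (volume.restrict (Ioc (-Real.pi) Real.pi)) := by
    simpa using integrable_circleKernel_mul hS n ε (h := fun _ => 1) continuousOn_const
  have hcl : ∀ᵐ y ∂(volume.restrict (Ioc (-Real.pi) Real.pi)), (z y).re < l.re :=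
    ae_of_all _ hzre
  have hci : Integrable (fun y => ‖circleKernel G n ε y‖ / (l.re - (z y).re))
      (volume.restrict (Ioc (-Real.pi) Real.pi)) := by
    have := (integrable_circleKernel_mul hS n ε (h := fun y => 1 / ((l.re - (z y).re : ℝ) : ℂ)) (by
      refine ContinuousOn.div continuousOn_const (by fun_prop) fun y _ => ?_
      rw [Complex.ofReal_ne_zero]
      linarith [hzre y])).norm
    refine this.congr (ae_of_all _ fun y => ?_)
    simp only [norm_mul, norm_div, norm_one, Complex.norm_real, Real.norm_eq_abs]
    rw [abs_of_pos (by linarith [hzre y])]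
    ring
  have hJ1 := integrableOn_cexp_mul_integral (z := fun ρ : ℝ => -(ρ : ℂ)) (by fun_prop) hrm hrl hri
  have hJ2 := integrableOn_cexp_mul_integral hzm hck.aestronglyMeasurable hcl hci
  have hE1 := integral_cexp_mul_integral (z := fun ρ : ℝ => -(ρ : ℂ)) (by fun_prop) hrm hrl hri
  have hE2 := integral_cexp_mul_integral hzm hck.aestronglyMeasurable hcl hci
  have hsplit : ∀ t : ℝ, Complex.exp (-(l * t)) * hankelIntegral G n ε 0 t =
      1 / (Real.pi : ℂ) * (Complex.exp (-(l * t)) *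
        ∫ ρ in Ioi ε, Complex.exp (t * -(ρ : ℂ)) * (rayKernel G n ρ : ℂ)) +
      1 / (2 * (Real.pi : ℂ) * Complex.I) * (Complex.exp (-(l * t)) *
        ∫ y in Ioc (-Real.pi) Real.pi, Complex.exp (t * z y) * circleKernel G n ε y) := by
    intro t
    simp only [hankelIntegral, pow_zero, one_mul, hz]
    ring
  simp only [hsplit]
  refine ⟨(hJ1.const_mul _).add (hJ2.const_mul _), ?_⟩
  rw [integral_add (hJ1.const_mul _) (hJ2.const_mul _), integral_const_mul, integral_const_mul,
    hE1, hE2]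
  -- `Φ†(z)^n / z^{n+1}` in the coordinate `w = log z`.
  let N : ℂ → ℂ := fun w => stripLift G w ^ n / Complex.exp w ^ (n + 1)
  have hNc : ContinuousOn N {w | Real.log ε ≤ w.re ∧ |w.im| ≤ Real.pi} :=
    ((hS.mono fun w hw => hw.2).pow n).div (by fun_prop)
      fun w _ => pow_ne_zero _ (Complex.exp_ne_zero _)
  have hNd : DifferentiableOn ℂ N {w | Real.log ε < w.re ∧ |w.im| < Real.pi} :=
    ((hSd.mono fun w hw => hw.2).pow n).div (by fun_prop)
      fun w _ => pow_ne_zero _ (Complex.exp_ne_zero _)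
  have hNb : ∀ w : ℂ, Real.log ε ≤ w.re → |w.im| ≤ Real.pi →
      ‖N w‖ ≤ C ^ n * Real.exp (-w.re) := by
    intro w h1 h2
    have h3 := norm_stripLift_le hC h2 ((Real.log_le_iff_le_exp hε).1 h1)
    simp only [N, norm_div, norm_pow, Complex.norm_exp]
    calc _ ≤ (C * Real.exp w.re) ^ n / Real.exp w.re ^ (n + 1) := by gcongr
      _ = _ := by rw [mul_pow, pow_succ, Real.exp_neg]; field_simp
  have hlnorm : Real.exp (Real.log ε) < ‖l‖ := by
    rw [Real.exp_log hε]
    exact hl.trans_le (Complex.re_le_norm l)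
  have key := (keyhole_cauchy_formula hl0 hlnorm hNc hNd hNb).2
  have hNl : N (Complex.log l) = (F l / l) ^ n * (1 / l) := by
    have him : |(Complex.log l).im| < Real.pi := by
      rw [Complex.log_im]
      exact (Complex.abs_arg_lt_pi_div_two_iff.2 (Or.inl hl0)).trans (by linarith)
    simp only [N, stripLift_eq hGF hF him, Complex.exp_log hlne]
    rw [div_pow, pow_succ]
    field_simp
  -- With `ρ = e^x`, the ray kernel is the lower boundary value minus the upper one, divided by
  -- `2i`; conjugate edges leave the imaginary part.
  have hray : ∫ ρ in Ioi ε, (rayKernel G n ρ : ℂ) / (l - -(ρ : ℂ)) =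
      1 / (2 * Complex.I) * ∫ x in Ioi (Real.log ε), (N (x - Real.pi * Complex.I) -
        N (x + Real.pi * Complex.I)) * (Complex.exp x / (Complex.exp x + l)) := by
    rw [integral_Ioi_comp_exp _ hε, ← integral_const_mul]
    congr 1
    ext x
    have hpe : Complex.exp (x + Real.pi * Complex.I) = -Complex.exp x := by
      rw [Complex.exp_add, Complex.exp_pi_mul_I]; ring
    have hme : Complex.exp (x - Real.pi * Complex.I) = -Complex.exp x := by
      rw [Complex.exp_sub, Complex.exp_pi_mul_I]; ring
    simp only [N, stripLift_add_pi, stripLift_sub_pi, hpe, hme, rayKernel]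
    have hconj : conj (G (-Complex.exp x)) ^ n - G (-Complex.exp x) ^ n =
        -2 * Complex.I * ((G (-Complex.exp x) ^ n).im : ℂ) := by
      rw [← map_pow]
      generalize G (-Complex.exp x) ^ n = u
      apply Complex.ext <;> simp
      ring
    have hden : Complex.exp x + l ≠ 0 := by
      intro h
      have := congrArg Complex.re h
      rw [← Complex.ofReal_exp] at this
      simp only [Complex.add_re, Complex.ofReal_re, Complex.zero_re] at this
      linarith [Real.exp_pos x]
    rw [← sub_div, hconj, neg_pow (Complex.exp (x : ℂ)), pow_succ (-1 : ℂ), Complex.real_smul]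
    push_cast
    rw [sub_neg_eq_add, add_comm l]
    have h1 : ((-1 : ℂ) ^ n) * (-1) ^ n = 1 := by rw [← mul_pow]; simp
    have h2 : ((-1 : ℂ) ^ n) ≠ 0 := by simp
    have hI := Complex.I_ne_zero
    field_simp
    rw [sq, h1, one_mul]
  have hcirc : ∫ y in Ioc (-Real.pi) Real.pi, circleKernel G n ε y / (l - z y) =
      Complex.I * ∫ y in (-Real.pi)..Real.pi, N (Real.log ε + y * Complex.I) *
        (Complex.exp (Real.log ε + y * Complex.I) /
          (l - Complex.exp (Real.log ε + y * Complex.I))) := by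
    rw [intervalIntegral.integral_of_le hpi', ← integral_const_mul]
    congr 1
    ext y
    simp only [N, circleKernel, hz]
    rw [pow_succ]
    have := Complex.exp_ne_zero (Real.log ε + y * Complex.I)
    field_simp
  rw [hray, hcirc, ← hNl]
  have hpc : (Real.pi : ℂ) ≠ 0 := by exact_mod_cast hpi.ne'
  have hI := Complex.I_ne_zero
  have e : N (Complex.log l) = 1 / (2 * Real.pi * Complex.I) *
      (2 * Real.pi * Complex.I * N (Complex.log l)) := by field_simp
  rw [e, key]
  field_simp

/-! ### Iterated derivatives and the final formula -/

/-- A real function on `(0, ∞)` that agrees with the first member of a chain of derivatives has the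
members of the chain as its iterated derivatives. -/
theorem iteratedDeriv_eq_of_hasDerivAt_chain {f : ℝ → ℝ} {h : ℕ → ℝ → ℂ}
    (hd : ∀ j, ∀ t : ℝ, 0 < t → HasDerivAt (h j) (h (j + 1) t) t)
    (hf : ∀ t, 0 < t → (f t : ℂ) = h 0 t) (j : ℕ) :
    ∀ t, 0 < t → DifferentiableAt ℝ (iteratedDeriv j f) t ∧ ((iteratedDeriv j f t : ℝ) : ℂ) = h j t := by
  have step : ∀ (g : ℝ → ℝ) (j : ℕ), (∀ t, 0 < t → (g t : ℂ) = h j t) → ∀ t, 0 < t →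
      DifferentiableAt ℝ g t ∧ ((deriv g t : ℝ) : ℂ) = h (j + 1) t := by
    intro g j hg t ht
    have h1 : HasDerivAt (fun s => (g s : ℂ)) (h (j + 1) t) t := by
      refine (hd j t ht).congr_of_eventuallyEq ?_
      filter_upwards [Ioi_mem_nhds ht] with s hs
      exact hg s hs
    -- The real part gives differentiability of `g`; uniqueness of the derivative then shows that `h
    -- (j + 1) t` is itself real.
    have h2 : HasDerivAt g (h (j + 1) t).re t :=
      Complex.reCLM.hasFDerivAt.comp_hasDerivAt t h1
    refine ⟨h2.differentiableAt, ?_⟩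
    have h3 : HasDerivAt (fun s => (g s : ℂ)) ((deriv g t : ℝ) : ℂ) t :=
      h2.differentiableAt.hasDerivAt.ofReal_comp
    exact h3.unique h1
  have main : ∀ j, ∀ t, 0 < t → ((iteratedDeriv j f t : ℝ) : ℂ) = h j t := by
    intro j
    induction j with
    | zero => simpa using hf
    | succ j ih =>
      intro t ht
      rw [iteratedDeriv_succ]
      exact (step _ j ih t ht).2
  exact fun t ht => ⟨(step _ j (main j) t ht).1, main j t ht⟩

theorem contDiffAt_of_differentiableAt_iteratedDeriv {f : ℝ → ℝ} {s : Set ℝ} (hs : IsOpen s)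
    (hf : ∀ j, ∀ t ∈ s, DifferentiableAt ℝ (iteratedDeriv j f) t) {t : ℝ} (ht : t ∈ s) (n : ℕ∞) :
    ContDiffAt ℝ n f t := by
  refine ContDiffOn.contDiffAt (s := s) ?_ (hs.mem_nhds ht)
  refine contDiffOn_of_differentiableOn_deriv fun m _ => ?_
  refine DifferentiableOn.congr (f := iteratedDeriv m f)
    (fun u hu => (hf m u hu).differentiableWithinAt) ?_
  exact iteratedDerivWithin_of_isOpen hs

/-- The exponent `r + 1` counts derivatives of the primitive: `ρ^{r+1} / ρ^{n+1} = 1 / ρ^{n-r}`, and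
the signs combine to `(-1)^{r+n+1}`. -/
theorem hankelIntegral_ray_eq (G : ℂ → ℂ) (n r : ℕ) (t : ℝ) {ρ : ℝ} (hρ : 0 < ρ) :
    (-(ρ : ℂ)) ^ (r + 1) * Complex.exp (t * -(ρ : ℂ)) * (rayKernel G n ρ : ℂ) =
      (rayIntegrand G n r t ρ : ℂ) := by
  have h1 : (-1 : ℂ) ^ (r + n + 1) * (G (-(ρ : ℂ)) ^ n / (ρ : ℂ) ^ ((n : ℤ) - (r : ℤ))) *
      Complex.exp (-((t : ℂ) * (ρ : ℂ))) =
      (((-1) ^ (r + n + 1) * (ρ ^ r / ρ ^ n) * Real.exp (-(t * ρ)) : ℝ) : ℂ) *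
        G (-(ρ : ℂ)) ^ n := by
    have hρc : (ρ : ℂ) ≠ 0 := by exact_mod_cast hρ.ne'
    rw [zpow_sub₀ hρc, zpow_natCast, zpow_natCast]
    push_cast
    field_simp
  rw [rayIntegrand, h1, Complex.im_ofReal_mul, rayKernel]
  have h2 : Complex.exp (t * -(ρ : ℂ)) = (Real.exp (-(t * ρ)) : ℂ) := by
    push_cast
    ring_nf
  rw [h2]
  have hne : (ρ : ℂ) ≠ 0 := by exact_mod_cast hρ.ne'
  rw [neg_pow (ρ : ℂ)]
  push_cast
  field_simp
  ring

/-- The endpoints `y = ±π` are excluded because they map to `-ε`, where the values of `F` are not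
controlled. -/
theorem hankelIntegral_circle_eq {F G : ℂ → ℂ}
    (hGF : ∀ z ∈ Complex.slitPlane, 0 ≤ z.im → G z = F z)
    (hF : ∀ z ∈ Complex.slitPlane, F (conj z) = conj (F z)) {ε : ℝ} (hε : 0 < ε) (n r : ℕ) (t : ℝ)
    {y : ℝ} (hy : |y| < Real.pi) :
    Complex.exp (Real.log ε + y * Complex.I) ^ (r + 1) *
        Complex.exp (t * Complex.exp (Real.log ε + y * Complex.I)) * circleKernel G n ε y =
      circlePullback (circleIntegrand F n r t) ε y := by
  have hz : (ε : ℂ) * Complex.exp (Complex.I * y) = Complex.exp (Real.log ε + y * Complex.I) := by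
    rw [Complex.exp_add, ← Complex.ofReal_exp, Real.exp_log hε, mul_comm Complex.I]
  rw [circlePullback, hz, circleIntegrand, circleKernel, stripLift_eq hGF hF (by simpa using hy)]
  have hne := Complex.exp_ne_zero (Real.log ε + y * Complex.I)
  rw [zpow_sub₀ hne, zpow_natCast, zpow_natCast]
  field_simp
  ring

theorem proposition3p15 (B : BernsteinFunction) (hB : B.IsComplete)
    (Φ : ℂ → ℂ) (hΦ : B.IsContinuation Φ)
    (Φp : ℂ → ℂ) (hΦp : IsUpperExtension Φ Φp)
    (hlim : Tendsto (fun z : ℂ => B.dagger Φp z / z)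
      (Bornology.cobounded ℂ ⊓ 𝓟 {z : ℂ | 0 ≤ z.im}) (𝓝 0))
    (ε t : ℝ) (hε : 0 < ε) (ht : 0 < t) (n r : ℕ) (hn : 1 ≤ n) :
    ContDiffAt ℝ (r : ℕ∞) (convPow B.tail n) t ∧
    IntegrableOn (rayIntegrand (B.dagger Φp) n r t) (Ioi ε) ∧
    IntervalIntegrable (circlePullback (circleIntegrand (B.dagger Φ) n r t) ε)
      volume (-Real.pi) Real.pi ∧
    ((iteratedDeriv r (convPow B.tail n) t : ℝ) : ℂ) =
      1 / (Real.pi : ℂ) *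
          ((∫ ρ in Ioi ε, rayIntegrand (B.dagger Φp) n r t ρ : ℝ) : ℂ) +
        1 / (2 * (Real.pi : ℂ) * Complex.I) *
          ∫ ξ in (-Real.pi)..Real.pi,
            circlePullback (circleIntegrand (B.dagger Φ) n r t) ε ξ := by
  have hpi' : -Real.pi ≤ Real.pi := by linarith [Real.pi_pos]
  set F := B.dagger Φ with hFdef
  set G := B.dagger Φp with hGdef
  have hGF : ∀ z ∈ Complex.slitPlane, 0 ≤ z.im → G z = F z := by
    intro z hz him
    simp only [hFdef, hGdef, BernsteinFunction.dagger,
      hΦp.eq_of_mem_slitPlane hΦ.1.continuousOn hz him]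
  have hF := hΦ.dagger_conj
  have hFd := hΦ.differentiableOn_dagger
  have hG : ContinuousOn G {z | 0 ≤ z.im} := BernsteinFunction.continuousOn_dagger hΦp.1
  have hS := continuousOn_stripLift hGF hF hFd hG
  obtain ⟨C, hC⟩ := exists_norm_le_mul_norm hG hlim hε
  have hL := (BernsteinFunction.hasLaplaceTransform_tail hB).convPow hn
  set f := convPow B.tail n
  -- Convolution with `1` is the primitive vanishing at `0`; it multiplies the transform by `1/z`.
  have hP := hL.halfLineConv hasLaplaceTransform_one
  have hd := fun j t ht => hasDerivAt_hankelIntegral hG hS hε hC n j (t := t) ht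
  have hprim : EqOn (fun t => (halfLineConv f (fun _ => 1) t : ℂ)) (hankelIntegral G n ε 0)
      (Ioi 0) := by
    refine eqOn_of_laplace_eq (c := ε + 1) (Complex.continuous_ofReal.comp_continuousOn hP.1)
      (fun t ht => (hd 0 t ht).continuousAt.continuousWithinAt) ?_ ?_ ?_
    · exact fun l hl => (hP.2 l (by rw [hl]; linarith)).1
    · exact fun l hl => (hankelIntegral_laplace hGF hF hFd hG hε hC n (by rw [hl]; linarith)).1
    · intro l hl
      rw [(hP.2 l (by rw [hl]; linarith)).2,
        (hankelIntegral_laplace hGF hF hFd hG hε hC n (by rw [hl]; linarith)).2]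
      simp only [hFdef, BernsteinFunction.dagger, hΦ.2 l (by rw [hl]; linarith)]
  -- Both sides are derivatives of the same primitive, one by the fundamental theorem of calculus
  -- and the other under the Hankel integral.
  have hf : ∀ t, 0 < t → (f t : ℂ) = hankelIntegral G n ε 1 t := by
    intro t ht
    have hcont : ContinuousAt f t := hL.1.continuousAt (Ioi_mem_nhds ht)
    have hmeas : StronglyMeasurableAtFilter f (𝓝 t) volume :=
      hL.1.stronglyMeasurableAtFilter isOpen_Ioi t ht
    have h1 : HasDerivAt (fun u => ∫ s in (0 : ℝ)..u, f s) (f t) t :=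
      intervalIntegral.integral_hasDerivAt_right
        ((intervalIntegrable_iff_integrableOn_Ioc_of_le ht.le).2 (hL.integrableOn_Ioc t))
        hmeas hcont
    have h2 : HasDerivAt (fun u => ((∫ s in (0 : ℝ)..u, f s : ℝ) : ℂ)) (f t) t := h1.ofReal_comp
    refine h2.unique ((hd 0 t ht).congr_of_eventuallyEq ?_)
    filter_upwards [Ioi_mem_nhds ht] with u hu
    rw [← hprim hu]
    simp only [halfLineConv, mul_one]
  have hchain := iteratedDeriv_eq_of_hasDerivAt_chain (h := fun j => hankelIntegral G n ε (j + 1))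
    (fun j t ht => hd (j + 1) t ht) hf
  have hray := fun ρ (hρ : ρ ∈ Ioi ε) => hankelIntegral_ray_eq G n r t (ρ := ρ) (hε.trans hρ)
  have hcirc : ∀ᵐ y : ℝ ∂(volume.restrict (Ioc (-Real.pi) Real.pi)),
      Complex.exp (Real.log ε + y * Complex.I) ^ (r + 1) *
        Complex.exp (t * Complex.exp (Real.log ε + y * Complex.I)) * circleKernel G n ε y =
      circlePullback (circleIntegrand F n r t) ε y := by
    -- On the half-open interval only `y = π` reaches the cut, a null set.
    have hne : ∀ᵐ y : ℝ, y ≠ Real.pi := by simp [ae_iff]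
    filter_upwards [ae_restrict_of_ae hne, ae_restrict_mem measurableSet_Ioc] with y h1 h2
    exact hankelIntegral_circle_eq hGF hF hε n r t (abs_lt.2 ⟨h2.1, lt_of_le_of_ne h2.2 h1⟩)
  refine ⟨?_, ?_, ?_, ?_⟩
  · exact contDiffAt_of_differentiableAt_iteratedDeriv isOpen_Ioi
      (fun j t ht => (hchain j t ht).1) ht r
  · have h1 : IntegrableOn (fun ρ => (rayIntegrand G n r t ρ : ℂ)) (Ioi ε) :=
      (show IntegrableOn _ _ _ from integrable_ray hG hε hC n ht (r + 1)).congr_fun hray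
        measurableSet_Ioi
    exact h1.re
  · rw [intervalIntegrable_iff_integrableOn_Ioc_of_le hpi']
    refine (integrable_circleKernel_mul hS n ε (h := fun y =>
      Complex.exp (Real.log ε + y * Complex.I) ^ (r + 1) *
        Complex.exp (t * Complex.exp (Real.log ε + y * Complex.I))) (by fun_prop)).congr hcirc
  · rw [(hchain r t ht).2, hankelIntegral, setIntegral_congr_fun measurableSet_Ioi hray,
      integral_congr_ae hcirc, intervalIntegral.integral_of_le hpi', integral_complex_ofReal]
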